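/- **Theorem 1.1.** Let $n\ge 3$, $\alpha\in(0,n)$, $s\in(0,1)$, $\lambda,\mu,\tau>0$ and $\frac{n+\alpha}{n}\le p\le\frac{n+\alpha}{n-2}$. Let $I_\alpha(x)=\dfrac{\Gamma(\frac{n-\alpha}{2})}{\pi^{n/2}2^{\alpha}\Gamma(\frac{\alpha}{2})}\,|x|^{\alpha-n}$ be the Riesz potential, and for real-valued $u,v\in H^1(\mathbb R^n)$ put $$\ll u,v\gg\;=\frac{C(n,s)}{2}\int_{\mathbb R^n}\int_{\mathbb R^n}\frac{(u(x)-u(y))(v(x)-v(y))}{|x-y|^{n+2s}}\,dx\,dy,\qquad C(n,s)=\Big(\int_{\mathbb R^n}\frac{1-\cos x_1}{|x|^{n+2s}}\,dx\Big)^{-1}.$$ Let $u\in H^1(\mathbb R^n)$ be a weak solution of $$-\Delta u+\lambda(-\Delta)^s u+u=\mu\,(I_\alpha*|u|^p)|u|^{p-2}u\ \text{ in }\mathbb R^n,\qquad \|u\|_2^2=\tau,\tag{1.1}$$ that is, $\|u\|_2^2=\tau$ and for every $v\in H^1(\mathbb R^n)$ $$\int_{\mathbb R^n}\nabla u\cdot\nabla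 v\,dx+\lambda\ll u,v\gg+\int_{\mathbb R^n}uv\,dx=\mu\int_{\mathbb R^n}(I_\alpha*|u|^p)|u|^{p-2}uv\,dx .$$ Then $u\in L^q(\mathbb R^n)$ for every $q\in\left[2,\frac{n}{\alpha}\,\frac{2n}{n-2}\right)$. -/

import Mathlib

open MeasureTheory
open scoped ContDiff ENNReal Convolution

noncomputable section

namespace Choquard

/-- The Riesz potential kernel `I_α(x) = A_{n,α} / |x|^{n-α}` on `ℝⁿ`, where
`A_{n,α} = Γ((n-α)/2) / (π^{n/2} 2^α Γ(α/2))`. -/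
def rieszKernel (n : ℕ) (α : ℝ) (x : EuclideanSpace ℝ (Fin n)) : ℝ :=
  Real.Gamma (((n : ℝ) - α) / 2) /
      (Real.pi ^ ((n : ℝ) / 2) * (2 : ℝ) ^ α * Real.Gamma (α / 2)) /
    ‖x‖ ^ ((n : ℝ) - α)

/-- The normalizing constant of the fractional Laplacian,
`C(n,s) = (∫_{ℝⁿ} (1 - cos x₁) / |x|^{n+2s} dx)⁻¹`. -/
def fracLapConst (n : ℕ) [NeZero n] (s : ℝ) : ℝ :=
  (∫ x : EuclideanSpace ℝ (Fin n),
    (1 - Real.cos (x 0)) / ‖x‖ ^ ((n : ℝ) + 2 * s))⁻¹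

/-- The bilinear form of `(-Δ)^s`:
`≪u,v≫ = C(n,s)/2 ∬ (u(x)-u(y)) (v(x)-v(y)) / |x-y|^{n+2s} dx dy`. -/
def gagliardoForm (n : ℕ) [NeZero n] (s : ℝ) (u v : EuclideanSpace ℝ (Fin n) → ℝ) : ℝ :=
  fracLapConst n s / 2 *
    ∫ z : EuclideanSpace ℝ (Fin n) × EuclideanSpace ℝ (Fin n),
      (u z.1 - u z.2) * (v z.1 - v z.2) / ‖z.1 - z.2‖ ^ ((n : ℝ) + 2 * s)

/-- `g` is the weak (distributional) gradient of `u` on `ℝⁿ`: both are locally integrable and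
`∫ u ∂ᵢφ = - ∫ gᵢ φ` for every test function `φ ∈ C_c^∞(ℝⁿ)` and every `i`. -/
structure HasWeakGradient {n : ℕ} (u : EuclideanSpace ℝ (Fin n) → ℝ)
    (g : EuclideanSpace ℝ (Fin n) → EuclideanSpace ℝ (Fin n)) : Prop where
  locallyIntegrable : LocallyIntegrable u
  locallyIntegrable_grad : LocallyIntegrable g
  integral_eq : ∀ φ : EuclideanSpace ℝ (Fin n) → ℝ, ContDiff ℝ ∞ φ → HasCompactSupport φ →
    ∀ i : Fin n,
      ∫ x, u x * fderiv ℝ φ x (EuclideanSpace.single i 1) = - ∫ x, g x i * φ x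

/-- `u ∈ H¹(ℝⁿ)` with weak gradient `g`: both `u` and `g` are square integrable.
The gradient `g` is determined by `u` up to a null set. -/
structure MemH1With {n : ℕ} (u : EuclideanSpace ℝ (Fin n) → ℝ)
    (g : EuclideanSpace ℝ (Fin n) → EuclideanSpace ℝ (Fin n)) : Prop where
  memLp : MemLp u 2
  memLp_grad : MemLp g 2
  hasWeakGradient : HasWeakGradient u g

/-- The Sobolev space `H¹(ℝⁿ)`. -/
def MemH1 {n : ℕ} (u : EuclideanSpace ℝ (Fin n) → ℝ) : Prop :=
  ∃ g, MemH1With u g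

/-- Weak solutions `u ∈ H¹(ℝⁿ)` of
`-Δu + lam (-Δ)^s u + u = μ (I_α * |u|^p) |u|^{p-2} u` in `ℝⁿ`, `‖u‖₂² = τ`.
The weak equation is tested with all `v ∈ H¹(ℝⁿ)`; `Du`, `Dv` are the weak gradients of `u`, `v`,
which are unique up to null sets. -/
structure IsWeakSolution (n : ℕ) [NeZero n] (α s p lam μ τ : ℝ)
    (u : EuclideanSpace ℝ (Fin n) → ℝ) : Prop where
  memH1 : MemH1 u
  mass : ∫ x, u x ^ 2 = τ
  weak_eq : ∀ Du, MemH1With u Du → ∀ v Dv, MemH1With v Dv →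
    (∫ x, inner ℝ (Du x) (Dv x)) + lam * gagliardoForm n s u v + (∫ x, u x * v x) =
      μ * ∫ x, (rieszKernel n α ⋆[ContinuousLinearMap.mul ℝ ℝ, volume] fun y => |u y| ^ p) x *
        (|u x| ^ (p - 2) * u x * v x)

end Choquard

end

/-!
The regularity comes from a bootstrap: if `u ∈ L^r` with `2 ≤ r < 2n/α`, then `u ∈ L^{rn/(n-2)}`.
Starting from `r = 2` and interpolating, all exponents below `(n/α) * 2n/(n-2)` are reached.

For one step, the equation is tested with `v = φ(u)`, where `φ' = min(|·|, L)^{r-2}`. Such a `φ` is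
`C¹` with bounded derivative, so `v ∈ H¹` by the chain rule (`MemH1With.comp_of_deriv_le`). Since
`φ` is increasing with `φ(0) = 0`, the fractional form `≪u, v≫` and `∫ u v` are nonnegative and
may be dropped, while `∇u · ∇v = |∇w|²` for `w = ψ(u)`, `ψ' = min(|·|, L)^{(r-2)/2}`. By the Sobolev
inequality (`exists_eLpNorm_le_of_memH1With`) the square of the critical norm of
`|u| min(|u|, L)^{(r-2)/2}`, which is comparable to `|w|`, is at most a constant times the
nonlinear term. The latter is bounded by the Riesz energy of `|u|^p min(|u|, L)^{r-2}` and `|u|^p`.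

The main point (`exists_rieszEnergy_truncation_le`) is that this energy is at most `C_ε` plus `ε`
times the same squared norm, with `C_ε` independent of `L`. At large values of `u` the power `p` may
be replaced by the critical one, `(n+α)/(n-2)`, and the Hardy–Littlewood–Sobolev inequality
(`exists_rieszEnergy_le`) together with Hölder's inequality bounds the energy by the squared norm
times a power of `∫_{|u| > M} |u|^{2n/(n-2)}`, which is small for large `M`. The condition
`r < 2n/α` guarantees that the Hardy–Littlewood–Sobolev exponents are admissible. The remaining
contributions, where one of the two factors is bounded, are subcritical. The squared norm is finite
for each `L`, so it can be absorbed; letting `L → ∞` with Fatou's lemma gives `u ∈ L^{rn/(n-2)}`.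
-/

namespace Choquard

open Set Filter Topology Module

/-! ### The Hardy–Littlewood–Sobolev inequality -/

section HLS

variable {E : Type*} [NormedAddCommGroup E] [NormedSpace ℝ E] [FiniteDimensional ℝ E]
  [MeasurableSpace E] [BorelSpace E]

/-- The set where the kernel exceeds `t` is a ball of measure proportional to `t ^ (-d / l)`; the
layer-cake formula is applied with the smaller of this quantity and `μ S`. -/
theorem exists_setLIntegral_norm_rpow_le (μ : Measure E) [μ.IsAddHaarMeasure] {l : ℝ}
    (hl0 : 0 < l) (hl : l < finrank ℝ E) :
    ∃ C : ℝ≥0∞, C ≠ ⊤ ∧ ∀ (S : Set E) (x : E),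
      ∫⁻ y in S, ENNReal.ofReal (‖x - y‖ ^ (-l)) ∂μ ≤ C * μ S ^ (1 - l / finrank ℝ E) := by
  set d : ℝ := (finrank ℝ E : ℝ) with hd
  have hd0 : 0 < d := hl0.trans hl
  have hdl : 1 < d / l := (one_lt_div hl0).2 hl
  have hκ : 0 < 1 - l / d := by rw [sub_pos, div_lt_one hd0]; exact hl
  have hsub : ∀ x : E, ∀ t : ℝ, 0 < t →
      μ {y | t < ‖x - y‖ ^ (-l)} ≤ ENNReal.ofReal (t ^ (-d / l)) * μ (Metric.ball 0 1) := by
    intro x t ht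
    have h1 : {y | t < ‖x - y‖ ^ (-l)} ⊆ Metric.ball x (t ^ (-1 / l)) := by
      intro y hy
      simp only [mem_ofPred_eq] at hy
      rcases (norm_nonneg (x - y)).eq_or_lt with h0 | h0
      · rw [← h0, Real.zero_rpow (by linarith)] at hy
        exact absurd hy ht.le.not_gt
      · have := Real.rpow_lt_rpow_of_neg ht hy (z := -1 / l) (by
          rw [neg_div, neg_lt_zero]; positivity)
        rw [← Real.rpow_mul h0.le] at this
        have e : -l * (-1 / l) = 1 := by field_simp
        rw [e, Real.rpow_one] at this
        rw [Metric.mem_ball, dist_comm, dist_eq_norm]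
        exact this
    refine (measure_mono h1).trans ?_
    rw [Measure.addHaar_ball_of_pos _ _ (by positivity), ← Real.rpow_natCast,
      ← Real.rpow_mul ht.le, ← hd]
    rw [show -1 / l * d = -d / l by ring]
  set B := μ (Metric.ball (0 : E) 1) with hB
  have hBt : B ≠ ⊤ := measure_ball_lt_top.ne
  refine ⟨1 + ENNReal.ofReal (1 / (d / l - 1)) * B, by finiteness, fun S x ↦ ?_⟩
  rcases eq_or_ne (μ S) 0 with h0 | h0
  · rw [setLIntegral_measure_zero _ _ h0]; exact zero_le
  rcases eq_or_ne (μ S) ⊤ with ht | ht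
  · rw [ht, ENNReal.top_rpow_of_pos hκ, ENNReal.mul_top (by simp)]; exact le_top
  set m := (μ S).toReal with hm
  have hm0 : 0 < m := ENNReal.toReal_pos h0 ht
  have hSm : μ S = ENNReal.ofReal m := (ENNReal.ofReal_toReal ht).symm
  -- The layer-cake integral is split where the two bounds for the measure of the level set agree.
  set T := m ^ (-l / d) with hT
  have hT0 : 0 < T := by positivity
  have hint : ∫⁻ t in Ioi T, ENNReal.ofReal (t ^ (-d / l)) =
      ENNReal.ofReal (1 / (d / l - 1)) * ENNReal.ofReal (m ^ (1 - l / d)) := by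
    have hlt : -d / l < -1 := by rw [neg_div]; linarith
    rw [← ofReal_integral_eq_lintegral_ofReal (integrableOn_Ioi_rpow_of_lt hlt hT0),
      integral_Ioi_rpow_of_lt hlt hT0, ← ENNReal.ofReal_mul (by
        apply one_div_nonneg.2; linarith)]
    · congr 1
      rw [hT, ← Real.rpow_mul hm0.le]
      have e : -l / d * (-d / l + 1) = 1 - l / d := by field_simp; ring
      rw [e]
      have : -d / l + 1 = -(d / l - 1) := by ring
      rw [this, neg_div_neg_eq]
      ring
    · filter_upwards [ae_restrict_mem measurableSet_Ioi] with t ht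
      have : 0 < t := hT0.trans ht
      positivity
  calc ∫⁻ y in S, ENNReal.ofReal (‖x - y‖ ^ (-l)) ∂μ
      = ∫⁻ t in Ioi (0 : ℝ), (μ.restrict S) {y | t < ‖x - y‖ ^ (-l)} := by
        apply lintegral_eq_lintegral_meas_lt
        · exact Eventually.of_forall fun y ↦ by positivity
        · fun_prop
    _ ≤ (∫⁻ t in Ioc 0 T, (μ.restrict S) {y | t < ‖x - y‖ ^ (-l)}) +
        ∫⁻ t in Ioi T, (μ.restrict S) {y | t < ‖x - y‖ ^ (-l)} := by
        rw [← Ioc_union_Ioi_eq_Ioi hT0.le]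
        exact lintegral_union_le _ _ _
    _ ≤ (∫⁻ t in Ioc 0 T, μ S) + ∫⁻ t in Ioi T, ENNReal.ofReal (t ^ (-d / l)) * B := by
        apply add_le_add
        · refine lintegral_mono fun t ↦ ?_
          exact (measure_mono (subset_univ _)).trans (by simp)
        · refine setLIntegral_mono (by fun_prop) fun t ht ↦ ?_
          exact (Measure.restrict_le_self _).trans (hsub x t (hT0.trans ht))
    _ = (1 + ENNReal.ofReal (1 / (d / l - 1)) * B) * μ S ^ (1 - l / d) := by
        rw [lintegral_mul_const _ (by fun_prop), hint, setLIntegral_const, Real.volume_Ioc, hSm,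
          ENNReal.ofReal_rpow_of_pos hm0, ← ENNReal.ofReal_mul hm0.le]
        have : m * (T - 0) = m ^ (1 - l / d) := by
          rw [hT, sub_zero, sub_eq_add_neg, Real.rpow_add hm0, Real.rpow_one, neg_div]
        rw [this]
        ring

theorem setLIntegral_Ioc_rpow {e S : ℝ} (he : -1 < e) (hS : 0 < S) :
    ∫⁻ t in Ioc 0 S, ENNReal.ofReal (t ^ e) = ENNReal.ofReal (S ^ (e + 1) / (e + 1)) := by
  have hi : IntegrableOn (fun t : ℝ ↦ t ^ e) (Ioc 0 S) :=
    (intervalIntegrable_iff_integrableOn_Ioc_of_le hS.le).1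
      (intervalIntegral.intervalIntegrable_rpow' he)
  rw [← ofReal_integral_eq_lintegral_ofReal hi, ← intervalIntegral.integral_of_le hS.le,
    integral_rpow (Or.inl he), Real.zero_rpow (by linarith), sub_zero]
  filter_upwards [ae_restrict_mem measurableSet_Ioc] with t ht
  exact Real.rpow_nonneg ht.1.le _

/-- Hölder's inequality for `w ^ κ = (w * t ^ (b - 1)) ^ κ * t ^ (-(b - 1) * κ)`. -/
theorem setLIntegral_Ioc_rpow_le {b κ : ℝ} (hκ0 : 0 < κ) (hκ1 : κ < 1)
    (hbκ : b * κ < 1) {w : ℝ → ℝ≥0∞} (hw : Measurable w)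
    (hB : ∫⁻ t in Ioi (0 : ℝ), w t * ENNReal.ofReal (t ^ (b - 1)) ≤ 1) {S : ℝ} (hS : 0 < S) :
    ∫⁻ t in Ioc 0 S, w t ^ κ ≤
      ENNReal.ofReal (((1 - κ) / (1 - b * κ)) ^ (1 - κ)) * ENNReal.ofReal (S ^ (1 - b * κ)) := by
  have hκ1' : 0 < 1 - κ := by linarith
  have hbκ' : 0 < 1 - b * κ := by linarith
  set f : ℝ → ℝ≥0∞ := fun t ↦ (w t * ENNReal.ofReal (t ^ (b - 1))) ^ κ with hf
  set g : ℝ → ℝ≥0∞ := fun t ↦ ENNReal.ofReal (t ^ (-((b - 1) * κ))) with hg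
  have hconj : (1 / κ).HolderConjugate (1 / (1 - κ)) := by
    rw [Real.holderConjugate_iff]
    refine ⟨(one_lt_div hκ0).2 hκ1, ?_⟩
    simp
  have hfg : ∫⁻ t in Ioc 0 S, w t ^ κ = ∫⁻ t in Ioc 0 S, (f * g) t := by
    refine setLIntegral_congr_fun measurableSet_Ioc fun t ht ↦ ?_
    have ht0 : 0 < t := ht.1
    simp only [hf, hg, Pi.mul_apply]
    rw [ENNReal.mul_rpow_of_nonneg _ _ hκ0.le, ENNReal.ofReal_rpow_of_pos (by positivity),
      mul_assoc, ← ENNReal.ofReal_mul (by positivity), ← Real.rpow_mul ht0.le,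
      ← Real.rpow_add ht0, add_neg_cancel, Real.rpow_zero, ENNReal.ofReal_one, mul_one]
  have h1 : ∫⁻ t in Ioc 0 S, f t ^ (1 / κ) ≤ 1 := by
    refine le_trans ?_ hB
    calc _ = ∫⁻ t in Ioc 0 S, w t * ENNReal.ofReal (t ^ (b - 1)) := by
          refine lintegral_congr fun t ↦ ?_
          simp only [hf]
          rw [← ENNReal.rpow_mul, mul_one_div_cancel hκ0.ne', ENNReal.rpow_one]
      _ ≤ _ := lintegral_mono_set Ioc_subset_Ioi_self
  have h2 : ∫⁻ t in Ioc 0 S, g t ^ (1 / (1 - κ)) =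
      ENNReal.ofReal (S ^ ((1 - b * κ) / (1 - κ)) * ((1 - κ) / (1 - b * κ))) := by
    calc _ = ∫⁻ t in Ioc 0 S, ENNReal.ofReal (t ^ (-((b - 1) * κ) / (1 - κ))) := by
          refine setLIntegral_congr_fun measurableSet_Ioc fun t ht ↦ ?_
          have ht0 : 0 < t := ht.1
          simp only [hg]
          rw [ENNReal.ofReal_rpow_of_pos (by positivity), ← Real.rpow_mul ht0.le,
            ← mul_div_assoc, mul_one]
      _ = _ := by
          have e : -((b - 1) * κ) / (1 - κ) + 1 = (1 - b * κ) / (1 - κ) := by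
            field_simp; ring
          rw [setLIntegral_Ioc_rpow _ hS, e]
          · congr 1
            field_simp
          · have : 0 < (1 - b * κ) / (1 - κ) := by positivity
            linarith
  rw [hfg]
  refine (ENNReal.lintegral_mul_le_Lp_mul_Lq _ hconj (by fun_prop) (by fun_prop)).trans ?_
  rw [h2]
  calc _ ≤ 1 * ENNReal.ofReal (S ^ ((1 - b * κ) / (1 - κ)) * ((1 - κ) / (1 - b * κ)))
        ^ (1 / (1 / (1 - κ))) := by
        gcongr
        exact ENNReal.rpow_le_one h1 (by positivity)
    _ = _ := by
        rw [one_mul, one_div_one_div, ENNReal.ofReal_rpow_of_pos (by positivity),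
          Real.mul_rpow (by positivity) (by positivity), ← Real.rpow_mul hS.le,
          div_mul_cancel₀ _ hκ1'.ne', ENNReal.ofReal_mul (by positivity), mul_comm]

theorem lintegral_mul_setLIntegral_rpow_le {a b κ : ℝ} (ha : 1 < a) (hb : 1 < b)
    (hκ0 : 0 < κ) (hab : 1 / a + 1 / b = 1 + κ) {v w : ℝ → ℝ≥0∞} (hv : Measurable v)
    (hw : Measurable w) (hA : ∫⁻ t in Ioi (0 : ℝ), v t * ENNReal.ofReal (t ^ (a - 1)) ≤ 1)
    (hB : ∫⁻ t in Ioi (0 : ℝ), w t * ENNReal.ofReal (t ^ (b - 1)) ≤ 1) :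
    ∫⁻ s in Ioi (0 : ℝ), v s * ∫⁻ t in Ioc 0 (s ^ (a / b)), w t ^ κ ≤
      ENNReal.ofReal (((1 - κ) / (1 - b * κ)) ^ (1 - κ)) := by
  have ha1 : 1 / a < 1 := (div_lt_one (by linarith)).2 ha
  have hb1 : 1 / b < 1 := (div_lt_one (by linarith)).2 hb
  have hbκ : b * κ < 1 := by
    have : κ < 1 / b := by linarith
    rwa [lt_div_iff₀ (by linarith), mul_comm] at this
  have hab' : a / b * (1 - b * κ) = a - 1 := by
    have : κ = 1 / a + 1 / b - 1 := by linarith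
    rw [this]; field_simp; ring
  calc _ ≤ ∫⁻ s in Ioi (0 : ℝ), ENNReal.ofReal (((1 - κ) / (1 - b * κ)) ^ (1 - κ)) *
        (v s * ENNReal.ofReal (s ^ (a - 1))) := by
        refine setLIntegral_mono (by fun_prop) fun s hs ↦ ?_
        have hs0 : 0 < s := hs
        refine (mul_le_mul_right (setLIntegral_Ioc_rpow_le hκ0 (by linarith) hbκ hw hB
          (S := s ^ (a / b)) (by positivity)) _).trans_eq ?_
        rw [← Real.rpow_mul hs0.le, hab']
        ring
    _ ≤ _ := by
        rw [lintegral_const_mul _ (by fun_prop)]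
        exact mul_le_of_le_one_right' hA

/-- The one-dimensional inequality behind the Hardy–Littlewood–Sobolev inequality: `v` and `w` play
the role of the distribution functions of the two factors, and the quarter plane is cut along
`t = s ^ (a / b)`. -/
theorem lintegral_lintegral_le_of_le_distribution {a b κ : ℝ} (ha : 1 < a) (hb : 1 < b)
    (hκ0 : 0 < κ) (hab : 1 / a + 1 / b = 1 + κ) {v w : ℝ → ℝ≥0∞} (hv : Measurable v)
    (hw : Measurable w) (hA : ∫⁻ t in Ioi (0 : ℝ), v t * ENNReal.ofReal (t ^ (a - 1)) ≤ 1)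
    (hB : ∫⁻ t in Ioi (0 : ℝ), w t * ENNReal.ofReal (t ^ (b - 1)) ≤ 1)
    {J : ℝ → ℝ → ℝ≥0∞} {C : ℝ≥0∞} (h₁ : ∀ s t, J s t ≤ C * (v s * w t ^ κ))
    (h₂ : ∀ s t, J s t ≤ C * (w t * v s ^ κ)) :
    ∫⁻ s in Ioi (0 : ℝ), ∫⁻ t in Ioi (0 : ℝ), J s t ≤
      C * (ENNReal.ofReal (((1 - κ) / (1 - b * κ)) ^ (1 - κ)) +
        ENNReal.ofReal (((1 - κ) / (1 - a * κ)) ^ (1 - κ))) := by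
  set D : Set (ℝ × ℝ) := {z | z.2 ≤ z.1 ^ (a / b)} with hD
  have hDm : MeasurableSet D := measurableSet_le (by fun_prop) (by fun_prop)
  set P : ℝ → ℝ → ℝ≥0∞ := fun s t ↦ D.indicator (fun z ↦ v z.1 * w z.2 ^ κ) (s, t) with hP
  set Q : ℝ → ℝ → ℝ≥0∞ := fun s t ↦ Dᶜ.indicator (fun z ↦ w z.2 * v z.1 ^ κ) (s, t) with hQ
  have hPm : Measurable (Function.uncurry P) :=
    Measurable.indicator (by fun_prop) hDm
  have hQm : Measurable (Function.uncurry Q) :=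
    Measurable.indicator (by fun_prop) hDm.compl
  have hJ : ∀ s t, J s t ≤ C * (P s t + Q s t) := by
    intro s t
    by_cases h : (s, t) ∈ D
    · simpa [hP, hQ, h] using h₁ s t
    · simpa [hP, hQ, h] using h₂ s t
  have hPle : ∫⁻ s in Ioi (0 : ℝ), ∫⁻ t in Ioi (0 : ℝ), P s t ≤
      ENNReal.ofReal (((1 - κ) / (1 - b * κ)) ^ (1 - κ)) := by
    refine le_trans (setLIntegral_mono' measurableSet_Ioi fun s hs ↦ ?_)
      (lintegral_mul_setLIntegral_rpow_le ha hb hκ0 hab hv hw hA hB)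
    have e : ∀ t ∈ Ioi (0 : ℝ), P s t =
        (Ioc 0 (s ^ (a / b))).indicator (fun t ↦ v s * w t ^ κ) t := by
      intro t ht
      have ht' : 0 < t := ht
      simp only [hP, hD, indicator, mem_ofPred_eq, mem_Ioc, ht', true_and]
    rw [setLIntegral_congr_fun measurableSet_Ioi e, ← lintegral_const_mul _ (by fun_prop),
      lintegral_indicator measurableSet_Ioc]
    exact lintegral_mono' (Measure.restrict_mono le_rfl Measure.restrict_le_self) le_rfl
  have hQle : ∫⁻ s in Ioi (0 : ℝ), ∫⁻ t in Ioi (0 : ℝ), Q s t ≤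
      ENNReal.ofReal (((1 - κ) / (1 - a * κ)) ^ (1 - κ)) := by
    rw [lintegral_lintegral_swap hQm.aemeasurable]
    refine le_trans (setLIntegral_mono' measurableSet_Ioi fun t ht ↦ ?_)
      (lintegral_mul_setLIntegral_rpow_le hb ha hκ0 (by rw [add_comm]; exact hab) hw hv hB hA)
    have ht' : 0 < t := ht
    have e : ∀ s ∈ Ioi (0 : ℝ), Q s t ≤
        (Ioc 0 (t ^ (b / a))).indicator (fun s ↦ w t * v s ^ κ) s := by
      intro s hs
      have hs' : 0 < s := hs
      by_cases h : (s, t) ∈ D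
      · simp [hQ, h]
      · have : s ∈ Ioc 0 (t ^ (b / a)) := by
          refine ⟨hs, ?_⟩
          simp only [hD, mem_ofPred_eq, not_le] at h
          have := Real.rpow_le_rpow (by positivity) h.le (z := b / a) (by positivity)
          rwa [← Real.rpow_mul hs'.le, show a / b * (b / a) = 1 by field_simp, Real.rpow_one]
            at this
        simp [hQ, h, this]
    refine (setLIntegral_mono' measurableSet_Ioi e).trans ?_
    rw [← lintegral_const_mul _ (by fun_prop), lintegral_indicator measurableSet_Ioc]
    exact lintegral_mono' (Measure.restrict_mono le_rfl Measure.restrict_le_self) le_rfl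
  calc _ ≤ ∫⁻ s in Ioi (0 : ℝ), ∫⁻ t in Ioi (0 : ℝ), C * (P s t + Q s t) :=
        lintegral_mono fun s ↦ lintegral_mono fun t ↦ hJ s t
    _ = C * ((∫⁻ s in Ioi (0 : ℝ), ∫⁻ t in Ioi (0 : ℝ), P s t) +
          ∫⁻ s in Ioi (0 : ℝ), ∫⁻ t in Ioi (0 : ℝ), Q s t) := by
        have h1 : ∀ s, Measurable (P s) := fun s ↦ hPm.comp measurable_prodMk_left
        have h2 : ∀ s, Measurable (Q s) := fun s ↦ hQm.comp measurable_prodMk_left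
        rw [← lintegral_add_left hPm.lintegral_prod_right, ← lintegral_const_mul]
        · refine lintegral_congr fun s ↦ ?_
          rw [← lintegral_add_left (h1 s)]
          exact lintegral_const_mul _ ((h1 s).add (h2 s))
        · exact hPm.lintegral_prod_right.add hQm.lintegral_prod_right
    _ ≤ _ := by gcongr

/-- The layer-cake formula with respect to the measure `V μ`. -/
theorem lintegral_ofReal_mul_eq_lintegral_setLIntegral {X : Type*} [MeasurableSpace X]
    {μ : Measure X} [SFinite μ] {f : X → ℝ} (hf0 : ∀ x, 0 ≤ f x) (hf : Measurable f)
    {V : X → ℝ≥0∞} (hV : Measurable V) :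
    ∫⁻ x, ENNReal.ofReal (f x) * V x ∂μ =
      ∫⁻ s in Ioi (0 : ℝ), ∫⁻ x in {x | s < f x}, V x ∂μ := by
  have h := lintegral_eq_lintegral_meas_lt (μ.withDensity V) (Eventually.of_forall hf0)
    hf.aemeasurable
  rw [lintegral_withDensity_eq_lintegral_mul _ hV (by fun_prop)] at h
  calc _ = ∫⁻ x, (V * fun x ↦ ENNReal.ofReal (f x)) x ∂μ := by
        simp only [Pi.mul_apply, mul_comm]
    _ = _ := by
        rw [h]
        refine lintegral_congr fun s ↦ withDensity_apply _ (measurableSet_lt measurable_const hf)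

/-- The double integral `∬ F(x) |x - y|⁻ˡ G(y) dx dy`. -/
noncomputable def rieszEnergy (μ : Measure E) (l : ℝ) (F G : E → ℝ≥0∞) : ℝ≥0∞ :=
  ∫⁻ x, F x * ∫⁻ y, ENNReal.ofReal (‖x - y‖ ^ (-l)) * G y ∂μ ∂μ

theorem exists_rieszEnergy_ofReal_le_of_normalized (μ : Measure E) [μ.IsAddHaarMeasure]
    {a b l : ℝ} (ha : 1 < a) (hb : 1 < b) (hl0 : 0 < l) (hl : l < finrank ℝ E)
    (hab : 1 / a + 1 / b + l / finrank ℝ E = 2) :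
    ∃ C : ℝ≥0∞, C ≠ ⊤ ∧ ∀ f g : E → ℝ, (∀ x, 0 ≤ f x) → (∀ x, 0 ≤ g x) → Measurable f →
      Measurable g → ∫⁻ x, ENNReal.ofReal (f x ^ a) ∂μ ≤ 1 → ∫⁻ x, ENNReal.ofReal (g x ^ b) ∂μ ≤ 1 →
      rieszEnergy μ l (fun x ↦ ENNReal.ofReal (f x)) (fun x ↦ ENNReal.ofReal (g x)) ≤ C := by
  obtain ⟨C, hC, hker⟩ := exists_setLIntegral_norm_rpow_le μ hl0 hl
  set d : ℝ := (finrank ℝ E : ℝ) with hd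
  have hd0 : 0 < d := hl0.trans hl
  set κ := 1 - l / d with hκ
  have hκ0 : 0 < κ := by rw [hκ, sub_pos, div_lt_one hd0]; exact hl
  refine ⟨C * (ENNReal.ofReal (((1 - κ) / (1 - b * κ)) ^ (1 - κ)) +
    ENNReal.ofReal (((1 - κ) / (1 - a * κ)) ^ (1 - κ))), by finiteness,
    fun f g hf0 hg0 hf hg hfa hgb ↦ ?_⟩
  have hdist : ∀ {h : E → ℝ} {c : ℝ}, 1 < c → (∀ x, 0 ≤ h x) → Measurable h →
      ∫⁻ x, ENNReal.ofReal (h x ^ c) ∂μ ≤ 1 →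
      ∫⁻ t in Ioi (0 : ℝ), μ {x | t < h x} * ENNReal.ofReal (t ^ (c - 1)) ≤ 1 := by
    intro h c hc h0 hm h1
    rw [lintegral_rpow_eq_lintegral_meas_lt_mul μ (Eventually.of_forall h0) hm.aemeasurable
      (by linarith)] at h1
    refine le_trans (le_mul_of_one_le_left' ?_) h1
    simpa using hc.le
  have hmeas : ∀ h : E → ℝ, Measurable fun t : ℝ ↦ μ {x | t < h x} := fun h ↦
    Antitone.measurable fun s t hst ↦ measure_mono fun x (hx : t < h x) ↦ hst.trans_lt hx
  set k : E → E → ℝ≥0∞ := fun x y ↦ ENNReal.ofReal (‖x - y‖ ^ (-l)) with hk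
  have hkm : Measurable (Function.uncurry k) := by
    simp only [hk, Function.uncurry_def]; fun_prop
  have hkG : Measurable (Function.uncurry fun x y ↦ k x y * ENNReal.ofReal (g y)) :=
    hkm.mul (hg.comp measurable_snd).ennreal_ofReal
  have hkm' : ∀ y, Measurable fun x ↦ k x y := fun y ↦ hkm.comp measurable_prodMk_right
  set J : ℝ → ℝ → ℝ≥0∞ := fun s t ↦
    ∫⁻ y in {y | t < g y}, ∫⁻ x in {x | s < f x}, k x y ∂μ ∂μ with hJ
  have hI : rieszEnergy μ l (fun x ↦ ENNReal.ofReal (f x)) (fun x ↦ ENNReal.ofReal (g x)) =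
      ∫⁻ s in Ioi (0 : ℝ), ∫⁻ t in Ioi (0 : ℝ), J s t := by
    rw [rieszEnergy, lintegral_ofReal_mul_eq_lintegral_setLIntegral hf0 hf]
    · refine lintegral_congr fun s ↦ ?_
      rw [lintegral_lintegral_swap]
      · rw [← lintegral_ofReal_mul_eq_lintegral_setLIntegral hg0 hg]
        · refine lintegral_congr fun y ↦ ?_
          rw [lintegral_mul_const _ (hkm' y), mul_comm]
        · exact hkm.lintegral_prod_left
      · exact hkG.aemeasurable
    · exact hkG.lintegral_prod_right
  rw [hI]
  refine lintegral_lintegral_le_of_le_distribution ha hb hκ0 (by rw [hκ]; linarith) (hmeas f)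
    (hmeas g) (hdist ha hf0 hf hfa) (hdist hb hg0 hg hgb) (fun s t ↦ ?_) (fun s t ↦ ?_)
  · simp only [hJ]
    rw [lintegral_lintegral_swap (f := fun y x ↦ k x y) (hkm.comp measurable_swap).aemeasurable]
    calc _ ≤ ∫⁻ x in {x | s < f x}, C * μ {y | t < g y} ^ κ ∂μ :=
          lintegral_mono fun x ↦ hker _ x
      _ = _ := by rw [setLIntegral_const]; ring
  · simp only [hJ]
    calc _ ≤ ∫⁻ y in {y | t < g y}, C * μ {x | s < f x} ^ κ ∂μ := by
          refine lintegral_mono fun y ↦ ?_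
          simp only [hk, norm_sub_rev _ y]
          exact hker _ y
      _ = _ := by rw [setLIntegral_const]; ring

/-- The **Hardy–Littlewood–Sobolev inequality**. -/
theorem exists_rieszEnergy_le (μ : Measure E) [μ.IsAddHaarMeasure]
    {a b l : ℝ} (ha : 1 < a) (hb : 1 < b) (hl0 : 0 < l) (hl : l < finrank ℝ E)
    (hab : 1 / a + 1 / b + l / finrank ℝ E = 2) :
    ∃ C : ℝ≥0∞, C ≠ ⊤ ∧ ∀ F G : E → ℝ≥0∞, (∀ x, F x ≠ ⊤) → (∀ x, G x ≠ ⊤) → Measurable F →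
      Measurable G →
      rieszEnergy μ l F G ≤ C * ((∫⁻ x, F x ^ a ∂μ) ^ (1 / a) * (∫⁻ x, G x ^ b ∂μ) ^ (1 / b)) := by
  obtain ⟨C, hC, h⟩ := exists_rieszEnergy_ofReal_le_of_normalized μ ha hb hl0 hl hab
  refine ⟨C + 1, by finiteness, fun F G hF hG hFm hGm ↦ ?_⟩
  have ha0 : 0 < a := by linarith
  have hb0 : 0 < b := by linarith
  have hz : ∀ {H : E → ℝ≥0∞} {c : ℝ}, 0 < c → Measurable H → (∫⁻ x, H x ^ c ∂μ) ^ (1 / c) = 0 →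
      H =ᵐ[μ] 0 := by
    intro H c hc hH h0
    rw [ENNReal.rpow_eq_zero_iff_of_pos (by positivity),
      lintegral_eq_zero_iff (by fun_prop)] at h0
    filter_upwards [h0] with x hx
    simpa [hc, hc.le.not_gt] using hx
  set A := (∫⁻ x, F x ^ a ∂μ) ^ (1 / a) with hA
  set B := (∫⁻ x, G x ^ b ∂μ) ^ (1 / b) with hB
  rcases eq_or_ne A 0 with hA0 | hA0
  · have hF0 := hz ha0 hFm hA0
    have : rieszEnergy μ l F G = 0 := by
      rw [rieszEnergy, lintegral_congr_ae (g := 0), Pi.zero_def, lintegral_zero]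
      filter_upwards [hF0] with x hx
      simp [hx]
    rw [this]; exact zero_le
  rcases eq_or_ne B 0 with hB0 | hB0
  · have hG0 := hz hb0 hGm hB0
    have : rieszEnergy μ l F G = 0 := by
      have e : ∀ x, ∫⁻ y, ENNReal.ofReal (‖x - y‖ ^ (-l)) * G y ∂μ = 0 := by
        intro x
        rw [lintegral_congr_ae (g := 0), Pi.zero_def, lintegral_zero]
        filter_upwards [hG0] with x hx
        simp [hx]
      simp [rieszEnergy, e]
    rw [this]; exact zero_le
  rcases eq_or_ne A ⊤ with hAt | hAt
  · rw [hAt, ENNReal.top_mul hB0, ENNReal.mul_top (by simp)]; exact le_top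
  rcases eq_or_ne B ⊤ with hBt | hBt
  · rw [hBt, ENNReal.mul_top hA0, ENNReal.mul_top (by simp)]; exact le_top
  have hnorm : ∀ {H : E → ℝ≥0∞} {c : ℝ}, 0 < c → (∀ x, H x ≠ ⊤) → Measurable H →
      (∫⁻ x, H x ^ c ∂μ) ^ (1 / c) ≠ 0 → (∫⁻ x, H x ^ c ∂μ) ^ (1 / c) ≠ ⊤ →
      ∫⁻ x, ENNReal.ofReal ((H x / (∫⁻ x, H x ^ c ∂μ) ^ (1 / c)).toReal ^ c) ∂μ ≤ 1 := by
    intro H c hc hH hHm h0 ht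
    set N := (∫⁻ x, H x ^ c ∂μ) ^ (1 / c) with hN
    have hNc : ∫⁻ x, H x ^ c ∂μ = N ^ c := by
      rw [hN, ← ENNReal.rpow_mul, one_div_mul_cancel hc.ne', ENNReal.rpow_one]
    have e : ∀ x, ENNReal.ofReal ((H x / N).toReal ^ c) = H x ^ c * (N ^ c)⁻¹ := by
      intro x
      rw [← ENNReal.ofReal_rpow_of_nonneg ENNReal.toReal_nonneg hc.le,
        ENNReal.ofReal_toReal (ENNReal.div_ne_top (hH x) h0),
        ENNReal.div_rpow_of_nonneg _ _ hc.le, div_eq_mul_inv]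
    simp_rw [e]
    rw [lintegral_mul_const _ (by fun_prop), hNc]
    exact ENNReal.mul_inv_le_one _
  have key := h (fun x ↦ (F x / A).toReal) (fun x ↦ (G x / B).toReal)
    (fun _ ↦ ENNReal.toReal_nonneg) (fun _ ↦ ENNReal.toReal_nonneg) (by fun_prop) (by fun_prop)
    (hnorm ha0 hF hFm hA0 hAt) (hnorm hb0 hG hGm hB0 hBt)
  have hFe : ∀ x, F x = A * ENNReal.ofReal (F x / A).toReal := fun x ↦ by
    rw [ENNReal.ofReal_toReal (ENNReal.div_ne_top (hF x) hA0), ENNReal.mul_div_cancel hA0 hAt]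
  have hGe : ∀ x, G x = B * ENNReal.ofReal (G x / B).toReal := fun x ↦ by
    rw [ENNReal.ofReal_toReal (ENNReal.div_ne_top (hG x) hB0), ENNReal.mul_div_cancel hB0 hBt]
  have hI : rieszEnergy μ l F G = A * B * rieszEnergy μ l
      (fun x ↦ ENNReal.ofReal (F x / A).toReal) (fun x ↦ ENNReal.ofReal (G x / B).toReal) := by
    simp only [rieszEnergy]
    rw [← lintegral_const_mul' _ _ (by finiteness)]
    refine lintegral_congr fun x ↦ ?_
    have : ∫⁻ y, ENNReal.ofReal (‖x - y‖ ^ (-l)) * G y ∂μ =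
        B * ∫⁻ y, ENNReal.ofReal (‖x - y‖ ^ (-l)) * ENNReal.ofReal (G y / B).toReal ∂μ := by
      rw [← lintegral_const_mul' _ _ hBt]
      refine lintegral_congr fun y ↦ ?_
      conv_lhs => rw [hGe y]
      ring
    rw [this]
    conv_lhs => rw [hFe x]
    ring
  rw [hI, mul_comm]
  gcongr
  exact key.trans le_self_add

end HLS

/-! ### Mollification of square integrable functions -/

/-- Almost everywhere convergence together with `‖fₖ‖₂ ≤ ‖f‖₂` gives convergence in `L²`: apply
Fatou's lemma to `2 |fₖ|² + 2 |f|² - |fₖ - f|² ≥ 0`. -/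
theorem tendsto_eLpNorm_sub_of_ae_tendsto_of_le {X G : Type*} [MeasurableSpace X] {μ : Measure X}
    [NormedAddCommGroup G] {f : ℕ → X → G} {g : X → G}
    (hf : ∀ k, AEStronglyMeasurable (f k) μ) (hg : MemLp g 2 μ)
    (hle : ∀ k, eLpNorm (f k) 2 μ ≤ eLpNorm g 2 μ)
    (hlim : ∀ᵐ x ∂μ, Tendsto (fun k ↦ f k x) atTop (𝓝 (g x))) :
    Tendsto (fun k ↦ eLpNorm (f k - g) 2 μ) atTop (𝓝 0) := by
  have hsq : ∀ h : X → G, eLpNorm h 2 μ = (∫⁻ x, ‖h x‖ₑ ^ 2 ∂μ) ^ (1 / 2 : ℝ) := by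
    intro h
    rw [eLpNorm_eq_lintegral_rpow_enorm_toReal (by norm_num) (by norm_num)]
    simp
  set N := ∫⁻ x, ‖g x‖ₑ ^ 2 ∂μ with hN
  have hNt : N ≠ ⊤ := by
    have := hg.2
    rw [hsq, ENNReal.rpow_lt_top_iff_of_pos (by norm_num)] at this
    exact this.ne
  have hfN : ∀ k, ∫⁻ x, ‖f k x‖ₑ ^ 2 ∂μ ≤ N := by
    intro k
    have := hle k
    rwa [hsq, hsq, ENNReal.rpow_le_rpow_iff (by norm_num)] at this
  set A : ℕ → X → ℝ≥0∞ := fun k x ↦ ‖f k x - g x‖ₑ ^ 2 with hA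
  set H : ℕ → X → ℝ≥0∞ := fun k x ↦ 2 * ‖f k x‖ₑ ^ 2 + 2 * ‖g x‖ₑ ^ 2 with hH
  have hAm : ∀ k, AEMeasurable (A k) μ := fun k ↦ ((hf k).sub hg.1).enorm.pow_const _
  have hHm : ∀ k, AEMeasurable (H k) μ := fun k ↦
    ((hf k).enorm.pow_const _ |>.const_mul _).add (hg.1.enorm.pow_const _ |>.const_mul _)
  have hAH : ∀ k x, A k x ≤ H k x := by
    intro k x
    have h1 : ‖f k x - g x‖ ^ 2 ≤ 2 * ‖f k x‖ ^ 2 + 2 * ‖g x‖ ^ 2 := by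
      have := norm_sub_le (f k x) (g x)
      nlinarith [sq_nonneg (‖f k x‖ - ‖g x‖), norm_nonneg (f k x - g x)]
    have h2 := ENNReal.ofReal_le_ofReal h1
    rw [ENNReal.ofReal_add (by positivity) (by positivity), ENNReal.ofReal_mul (by norm_num),
      ENNReal.ofReal_mul (by norm_num), ENNReal.ofReal_pow (norm_nonneg _),
      ENNReal.ofReal_pow (norm_nonneg _), ENNReal.ofReal_pow (norm_nonneg _)] at h2
    simpa [hA, hH, ofReal_norm] using h2
  have hHint : ∀ k, ∫⁻ x, H k x ∂μ ≤ 4 * N := by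
    intro k
    simp only [hH]
    rw [lintegral_add_left' ((hf k).enorm.pow_const _ |>.const_mul _),
      lintegral_const_mul' _ _ (by norm_num), lintegral_const_mul' _ _ (by norm_num)]
    calc _ ≤ 2 * N + 2 * N := by gcongr; exact hfN k
      _ = 4 * N := by ring
  have hadd : ∀ k, (∫⁻ x, H k x - A k x ∂μ) + ∫⁻ x, A k x ∂μ ≤ 4 * N := by
    intro k
    rw [← lintegral_add_right' _ (hAm k)]
    refine le_trans (le_of_eq (lintegral_congr fun x ↦ ?_)) (hHint k)
    exact tsub_add_cancel_of_le (hAH k x)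
  have hfatou : 4 * N ≤ liminf (fun k ↦ ∫⁻ x, H k x - A k x ∂μ) atTop := by
    refine le_trans (le_of_eq ?_) (lintegral_liminf_le' fun k ↦ (hHm k).sub (hAm k))
    rw [hN, ← lintegral_const_mul' _ _ (by norm_num)]
    refine lintegral_congr_ae ?_
    filter_upwards [hlim] with x hx
    have h1 : Tendsto (fun k ↦ H k x) atTop (𝓝 (2 * ‖g x‖ₑ ^ 2 + 2 * ‖g x‖ₑ ^ 2)) := by
      refine Tendsto.add ?_ tendsto_const_nhds
      refine ENNReal.Tendsto.const_mul ?_ (Or.inr (by norm_num))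
      exact (ENNReal.continuous_pow 2).continuousAt.tendsto.comp hx.enorm
    have h2 : Tendsto (fun k ↦ A k x) atTop (𝓝 0) := by
      have := (ENNReal.continuous_pow 2).continuousAt.tendsto.comp (hx.sub_const (g x)).enorm
      simpa [hA, Function.comp_def] using this
    have h3 := ENNReal.Tendsto.sub h1 h2 (Or.inr (by norm_num))
    rw [h3.liminf_eq, tsub_zero]
    ring
  have hlimA : Tendsto (fun k ↦ ∫⁻ x, A k x ∂μ) atTop (𝓝 0) := by
    rw [ENNReal.tendsto_nhds_zero]
    intro ε hε
    rcases eq_or_ne (4 * N) 0 with h0 | h0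
    · refine Eventually.of_forall fun k ↦ ?_
      exact (le_add_self.trans ((hadd k).trans h0.le)).trans zero_le
    rcases eq_or_ne ε ⊤ with rfl | hεt
    · exact Eventually.of_forall fun k ↦ le_top
    have hlt : 4 * N - ε < liminf (fun k ↦ ∫⁻ x, H k x - A k x ∂μ) atTop :=
      (ENNReal.sub_lt_self (by finiteness) h0 hε.ne').trans_le hfatou
    filter_upwards [eventually_lt_of_lt_liminf hlt] with k hk
    by_contra! hcon
    have h5 : 4 * N < (∫⁻ x, H k x - A k x ∂μ) + ∫⁻ x, A k x ∂μ := by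
      calc 4 * N ≤ (4 * N - ε) + ε := le_tsub_add
        _ < _ := ENNReal.add_lt_add hk hcon
    exact absurd (hadd k) h5.not_ge
  have := (ENNReal.continuous_rpow_const (y := (1 / 2 : ℝ))).continuousAt.tendsto.comp hlimA
  simp only [hsq, Pi.sub_apply]
  simpa [hA, Function.comp_def] using this

section Mollification

variable {n : ℕ} {F : Type*} [NormedAddCommGroup F] [NormedSpace ℝ F]

/-- A sequence of smooth bump functions shrinking to the origin, with a fixed ratio of radii. -/
noncomputable def mollifier (n k : ℕ) : ContDiffBump (0 : EuclideanSpace ℝ (Fin n)) where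
  rIn := 1 / (k + 1)
  rOut := 2 / (k + 1)
  rIn_pos := by positivity
  rIn_lt_rOut := by gcongr; norm_num

/-- The mollification `ρₖ * g` of `g` with the normalized bump function `ρₖ`. -/
noncomputable def mollify (k : ℕ) (g : EuclideanSpace ℝ (Fin n) → F) :
    EuclideanSpace ℝ (Fin n) → F :=
  (mollifier n k).normed volume ⋆[ContinuousLinearMap.lsmul ℝ ℝ, volume] g

theorem ae_tendsto_mollify [CompleteSpace F] {g : EuclideanSpace ℝ (Fin n) → F}
    (hg : LocallyIntegrable g) :
    ∀ᵐ x, Tendsto (fun k ↦ mollify k g x) atTop (𝓝 (g x)) := by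
  refine ContDiffBump.ae_convolution_tendsto_right_of_locallyIntegrable (K := 2) ?_ ?_ hg
  · have := (tendsto_one_div_add_atTop_nhds_zero_nat (𝕜 := ℝ)).const_mul 2
    simpa [mollifier, ← div_eq_mul_inv] using this
  · refine Eventually.of_forall fun k ↦ le_of_eq ?_
    simp [mollifier, div_eq_mul_inv]

theorem continuous_mollify {g : EuclideanSpace ℝ (Fin n) → F} (hg : LocallyIntegrable g) (k : ℕ) :
    Continuous (mollify k g) :=
  (mollifier n k).hasCompactSupport_normed.continuous_convolution_left _
    (mollifier n k).continuous_normed hg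

theorem contDiff_mollify {g : EuclideanSpace ℝ (Fin n) → F} (hg : LocallyIntegrable g) (k : ℕ) :
    ContDiff ℝ 1 (mollify k g) :=
  (mollifier n k).hasCompactSupport_normed.contDiff_convolution_left (n := 1) _
    (mollifier n k).contDiff_normed hg

theorem eLpNorm_mollify_le {g : EuclideanSpace ℝ (Fin n) → F} (hg : AEStronglyMeasurable g)
    (k : ℕ) : eLpNorm (mollify k g) 2 volume ≤ eLpNorm g 2 volume := by
  wlog hgm : StronglyMeasurable g generalizing g
  · have e : mollify k g = mollify k (hg.mk g) :=
      convolution_congr _ EventuallyEq.rfl hg.ae_eq_mk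
    rw [e, eLpNorm_congr_ae hg.ae_eq_mk]
    exact this hg.stronglyMeasurable_mk.aestronglyMeasurable hg.stronglyMeasurable_mk
  set ρ := (mollifier n k).normed volume with hρ
  have hρ0 : ∀ x, 0 ≤ ρ x := (mollifier n k).nonneg_normed
  have hρm : Measurable fun t ↦ ENNReal.ofReal (ρ t) :=
    (mollifier n k).continuous_normed.measurable.ennreal_ofReal
  -- The mollification is an average with respect to the probability measure `ρ dx`.
  set ν : Measure (EuclideanSpace ℝ (Fin n)) := volume.withDensity fun t ↦ ENNReal.ofReal (ρ t)
    with hν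
  have hν1 : IsProbabilityMeasure ν := by
    constructor
    rw [hν, withDensity_apply _ MeasurableSet.univ, setLIntegral_univ,
      ← ofReal_integral_eq_lintegral_ofReal (mollifier n k).integrable_normed
        (Eventually.of_forall hρ0), (mollifier n k).integral_normed, ENNReal.ofReal_one]
  have hpt : ∀ x, ‖mollify k g x‖ₑ ^ (2 : ℝ) ≤
      ∫⁻ t, ENNReal.ofReal (ρ t) * ‖g (x - t)‖ₑ ^ (2 : ℝ) := by
    intro x
    have hgx : StronglyMeasurable fun t ↦ g (x - t) := hgm.comp_measurable (by fun_prop)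
    have h1 : ‖mollify k g x‖ₑ ≤ eLpNorm (fun t ↦ g (x - t)) 1 ν := by
      rw [eLpNorm_one_eq_lintegral_enorm, hν,
        lintegral_withDensity_eq_lintegral_mul _ hρm hgx.enorm]
      refine (enorm_integral_le_lintegral_enorm _).trans_eq ?_
      refine lintegral_congr fun t ↦ ?_
      simp only [ContinuousLinearMap.lsmul_apply, enorm_smul, Pi.mul_apply]
      rw [Real.enorm_of_nonneg (hρ0 t)]
    have h2 := h1.trans (eLpNorm_le_eLpNorm_of_exponent_le (by norm_num : (1 : ℝ≥0∞) ≤ 2)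
      hgx.aestronglyMeasurable)
    have h3 : eLpNorm (fun t ↦ g (x - t)) 2 ν ^ (2 : ℝ) =
        ∫⁻ t, ENNReal.ofReal (ρ t) * ‖g (x - t)‖ₑ ^ (2 : ℝ) := by
      rw [eLpNorm_eq_lintegral_rpow_enorm_toReal (by norm_num) (by norm_num), ← ENNReal.rpow_mul]
      simp only [ENNReal.toReal_ofNat]
      rw [one_div_mul_cancel (by norm_num), ENNReal.rpow_one, hν,
        lintegral_withDensity_eq_lintegral_mul _ hρm (hgx.enorm.pow_const _)]
      rfl
    rw [← h3]
    exact ENNReal.rpow_le_rpow h2 (by norm_num)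
  rw [eLpNorm_eq_lintegral_rpow_enorm_toReal (by norm_num) (by norm_num),
    eLpNorm_eq_lintegral_rpow_enorm_toReal (by norm_num) (by norm_num)]
  simp only [ENNReal.toReal_ofNat]
  gcongr ?_ ^ _
  calc ∫⁻ x, ‖mollify k g x‖ₑ ^ (2 : ℝ)
      ≤ ∫⁻ x, ∫⁻ t, ENNReal.ofReal (ρ t) * ‖g (x - t)‖ₑ ^ (2 : ℝ) := lintegral_mono hpt
    _ = ∫⁻ t, ∫⁻ x, ENNReal.ofReal (ρ t) * ‖g (x - t)‖ₑ ^ (2 : ℝ) := by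
        apply lintegral_lintegral_swap
        refine Measurable.aemeasurable ?_
        refine (hρm.comp measurable_snd).mul ?_
        exact (hgm.comp_measurable (by fun_prop)).enorm.pow_const _
    _ = ∫⁻ t, ENNReal.ofReal (ρ t) * ∫⁻ x, ‖g x‖ₑ ^ (2 : ℝ) := by
        refine lintegral_congr fun t ↦ ?_
        rw [lintegral_const_mul' _ _ (by finiteness),
          lintegral_sub_right_eq_self (fun x ↦ ‖g x‖ₑ ^ (2 : ℝ))]
    _ = ∫⁻ x, ‖g x‖ₑ ^ (2 : ℝ) := by
        rw [lintegral_mul_const _ hρm]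
        have := hν1.measure_univ
        rw [hν, withDensity_apply _ MeasurableSet.univ, setLIntegral_univ] at this
        rw [this, one_mul]

theorem memLp_mollify {g : EuclideanSpace ℝ (Fin n) → F} (hg : MemLp g 2) (k : ℕ) :
    MemLp (mollify k g) 2 :=
  ⟨(continuous_mollify (hg.locallyIntegrable (by norm_num)) k).aestronglyMeasurable,
    (eLpNorm_mollify_le hg.1 k).trans_lt hg.2⟩

theorem tendsto_eLpNorm_mollify_sub [CompleteSpace F] {g : EuclideanSpace ℝ (Fin n) → F}
    (hg : MemLp g 2) : Tendsto (fun k ↦ eLpNorm (mollify k g - g) 2 volume) atTop (𝓝 0) :=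
  have hl := hg.locallyIntegrable (by norm_num)
  tendsto_eLpNorm_sub_of_ae_tendsto_of_le (fun k ↦ (continuous_mollify hl k).aestronglyMeasurable)
    hg (eLpNorm_mollify_le hg.1) (ae_tendsto_mollify hl)

end Mollification

/-! ### The Sobolev inequality and the chain rule in `H¹` -/

section Gradient

variable {n : ℕ}

theorem HasWeakGradient.fderiv_mollify {u : EuclideanSpace ℝ (Fin n) → ℝ}
    {g : EuclideanSpace ℝ (Fin n) → EuclideanSpace ℝ (Fin n)} (h : HasWeakGradient u g) (k : ℕ)
    (x : EuclideanSpace ℝ (Fin n)) :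
    fderiv ℝ (mollify k u) x = innerSL ℝ (mollify k g x) := by
  set ρ := (mollifier n k).normed volume with hρ
  have hρc : HasCompactSupport ρ := (mollifier n k).hasCompactSupport_normed
  have hρs : ContDiff ℝ ∞ ρ := (mollifier n k).contDiff_normed
  have hd : fderiv ℝ (mollify k u) x = _ :=
    (hρc.hasFDerivAt_convolution_left (ContinuousLinearMap.lsmul ℝ ℝ) (hρs.of_le (by simp))
      h.locallyIntegrable x).fderiv
  rw [hd]
  refine ContinuousLinearMap.coe_injective
    ((EuclideanSpace.basisFun (Fin n) ℝ).toBasis.ext fun i ↦ ?_)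
  simp only [OrthonormalBasis.coe_toBasis, EuclideanSpace.basisFun_apply,
    ContinuousLinearMap.coe_coe, innerSL_apply_apply]
  rw [EuclideanSpace.inner_single_right]
  have h1 : ((fderiv ℝ ρ ⋆[(ContinuousLinearMap.lsmul ℝ ℝ).precompL (EuclideanSpace ℝ (Fin n)),
      volume] u) x) (EuclideanSpace.single i 1) =
      ∫ y, fderiv ℝ ρ (x - y) (EuclideanSpace.single i 1) * u y := by
    rw [convolution_eq_swap, ContinuousLinearMap.integral_apply]
    · rfl
    · exact ((hρc.fderiv ℝ).convolutionExists_left _ (hρs.continuous_fderiv (by simp))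
        h.locallyIntegrable x).integrable_swap
  have h2 : mollify k g x i = ∫ y, ρ (x - y) * g y i := by
    have hi : Integrable (fun y ↦ ρ (x - y) • g y) :=
      (hρc.convolutionExists_left (ContinuousLinearMap.lsmul ℝ ℝ) hρs.continuous
        h.locallyIntegrable_grad x).integrable_swap
    have := (EuclideanSpace.proj i : EuclideanSpace ℝ (Fin n) →L[ℝ] ℝ).integral_comp_comm hi
    rw [mollify, convolution_eq_swap]
    exact this.symm
  have h3 := h.integral_eq (fun y ↦ ρ (x - y)) (hρs.comp (contDiff_const.sub contDiff_id))
    (hρc.comp_homeomorph (Homeomorph.subLeft x)) i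
  have h4 : ∀ y, fderiv ℝ (fun y ↦ ρ (x - y)) y (EuclideanSpace.single i 1) =
      - fderiv ℝ ρ (x - y) (EuclideanSpace.single i 1) := by
    intro y
    have ha : HasFDerivAt ρ (fderiv ℝ ρ (x - y)) (x - y) :=
      (hρs.differentiable (by simp)).differentiableAt.hasFDerivAt
    have hb : HasFDerivAt (fun y ↦ x - y) (-ContinuousLinearMap.id ℝ _) y :=
      (hasFDerivAt_id y).const_sub x
    change fderiv ℝ (ρ ∘ fun y ↦ x - y) y _ = _
    rw [(ha.comp y hb).fderiv]
    simp
  simp only [h4, mul_neg, integral_neg, neg_inj] at h3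
  rw [h1, h2]
  simp only [mul_comm _ (u _), conj_trivial]
  rw [h3, one_mul]
  simp only [mul_comm]

/-- The **Sobolev inequality** on `H¹(ℝⁿ)`: it is inherited from compactly supported `C¹` functions
by Fatou's lemma along the truncated mollifications `χ(x / k) (ρₖ * w)(x)`, whose gradients are
bounded by `‖∇w‖₂ + O(1 / k)` in `L²`. -/
theorem exists_eLpNorm_le_of_memH1With (hn : 3 ≤ n) :
    ∃ C : ℝ≥0∞, C ≠ ⊤ ∧ ∀ (w : EuclideanSpace ℝ (Fin n) → ℝ)
      (g : EuclideanSpace ℝ (Fin n) → EuclideanSpace ℝ (Fin n)), MemH1With w g →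
      eLpNorm w (ENNReal.ofReal (2 * n / (n - 2))) volume ≤ C * eLpNorm g 2 volume := by
  have hn' : (3 : ℝ) ≤ n := by exact_mod_cast hn
  set p' : NNReal := (2 * n / (n - 2) : ℝ).toNNReal with hp'
  have hp'c : (p' : ℝ) = 2 * n / (n - 2) := Real.coe_toNNReal _ (by
    apply div_nonneg <;> linarith)
  set C := SNormLESNormFDerivOfEqConst ℝ (volume : Measure (EuclideanSpace ℝ (Fin n))) 2 with hC
  have hsob : ∀ v : EuclideanSpace ℝ (Fin n) → ℝ, ContDiff ℝ 1 v → HasCompactSupport v →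
      eLpNorm v p' volume ≤ C * eLpNorm (fderiv ℝ v) 2 volume := by
    intro v hv hvc
    have := eLpNorm_le_eLpNorm_fderiv_of_eq (volume : Measure (EuclideanSpace ℝ (Fin n))) hv hvc
      (p := 2) (p' := p') (by norm_num) (by simp; omega) (by
        rw [hp'c, finrank_euclideanSpace_fin]
        have : (n : ℝ) - 2 ≠ 0 := by linarith
        have : (n : ℝ) ≠ 0 := by linarith
        push_cast
        field_simp)
    simpa using this
  refine ⟨C, by finiteness, fun w g h ↦ ?_⟩
  have hwl := h.memLp.locallyIntegrable (by norm_num)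
  have hgl := h.memLp_grad.locallyIntegrable (by norm_num)
  let χ : ContDiffBump (0 : EuclideanSpace ℝ (Fin n)) := ⟨1, 2, one_pos, one_lt_two⟩
  have hχs : ContDiff ℝ 1 χ := χ.contDiff
  obtain ⟨M, hM⟩ : ∃ M : ℝ, ∀ x, ‖fderiv ℝ χ x‖ ≤ M :=
    (χ.hasCompactSupport.fderiv ℝ).exists_bound_of_continuous (hχs.continuous_fderiv (by simp))
  have hM0 : 0 ≤ M := (norm_nonneg _).trans (hM 0)
  set c : ℕ → ℝ := fun k ↦ 1 / ((k : ℝ) + 1) with hc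
  have hc0 : ∀ k, 0 < c k := fun k ↦ by positivity
  set ζ : ℕ → EuclideanSpace ℝ (Fin n) → ℝ := fun k x ↦ χ (c k • x) with hζ
  have hζs : ∀ k, ContDiff ℝ 1 (ζ k) := fun k ↦ hχs.comp (contDiff_id.const_smul (c k))
  have hζc : ∀ k, HasCompactSupport (ζ k) := fun k ↦
    χ.hasCompactSupport.comp_smul (hc0 k).ne'
  have hζd : ∀ k x, ‖fderiv ℝ (ζ k) x‖ ≤ M * c k := by
    intro k x
    have h1 : HasFDerivAt (ζ k) _ x := HasFDerivAt.comp (g := χ) (f := fun x ↦ c k • x) x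
      (hχs.differentiable (by simp)).differentiableAt.hasFDerivAt
      ((hasFDerivAt_id x).const_smul (c k))
    rw [h1.fderiv]
    refine (ContinuousLinearMap.opNorm_comp_le _ _).trans ?_
    refine mul_le_mul (hM _) ?_ (norm_nonneg _) hM0
    rw [norm_smul, Real.norm_of_nonneg (hc0 k).le]
    exact mul_le_of_le_one_right (hc0 k).le ContinuousLinearMap.norm_id_le
  set Z : ℕ → EuclideanSpace ℝ (Fin n) → ℝ := fun k x ↦ ζ k x * mollify k w x with hZ
  have hZs : ∀ k, ContDiff ℝ 1 (Z k) := fun k ↦ (hζs k).mul (contDiff_mollify hwl k)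
  have hZbound : ∀ k, eLpNorm (Z k) p' volume ≤
      C * (eLpNorm g 2 volume + ENNReal.ofReal (M * c k) * eLpNorm w 2 volume) := by
    intro k
    refine (hsob _ (hZs k) ((hζc k).mul_right)).trans ?_
    gcongr
    have hgm := (continuous_mollify hgl k).aestronglyMeasurable (μ := volume)
    have hwm := (continuous_mollify hwl k).aestronglyMeasurable (μ := volume)
    calc eLpNorm (fderiv ℝ (Z k)) 2 volume
        ≤ eLpNorm ((fun x ↦ ‖mollify k g x‖) + fun x ↦ (M * c k) * ‖mollify k w x‖) 2 volume := by
          refine eLpNorm_mono_real fun x ↦ ?_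
          have h1 : fderiv ℝ (Z k) x = ζ k x • fderiv ℝ (mollify k w) x +
              mollify k w x • fderiv ℝ (ζ k) x :=
            fderiv_fun_mul ((hζs k).differentiable (by simp)).differentiableAt
              ((contDiff_mollify hwl k).differentiable (by simp)).differentiableAt
          rw [h1]
          refine (norm_add_le _ _).trans ?_
          rw [norm_smul, norm_smul, h.hasWeakGradient.fderiv_mollify, innerSL_apply_norm,
            Real.norm_of_nonneg χ.nonneg]
          have h2 : ζ k x ≤ 1 := χ.le_one
          have h3 := hζd k x
          simp only [Pi.add_apply]
          have h4 := mul_le_mul_of_nonneg_left h3 (norm_nonneg (mollify k w x))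
          have h5 := mul_le_mul_of_nonneg_right h2 (norm_nonneg (mollify k g x))
          simp only [hζ] at *
          linarith
      _ ≤ eLpNorm (fun x ↦ ‖mollify k g x‖) 2 volume +
          eLpNorm (fun x ↦ (M * c k) * ‖mollify k w x‖) 2 volume :=
          eLpNorm_add_le hgm.norm (hwm.norm.const_mul _) (by norm_num)
      _ ≤ eLpNorm g 2 volume + ENNReal.ofReal (M * c k) * eLpNorm w 2 volume := by
          gcongr
          · rw [eLpNorm_norm]
            exact eLpNorm_mollify_le h.memLp_grad.1 k
          · have e := eLpNorm_const_smul (M * c k) (fun x ↦ ‖mollify k w x‖) 2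
              (volume : Measure (EuclideanSpace ℝ (Fin n)))
            rw [Real.enorm_of_nonneg (mul_nonneg hM0 (hc0 k).le), eLpNorm_norm] at e
            refine (le_of_eq e).trans ?_
            gcongr
            exact eLpNorm_mollify_le h.memLp.1 k
  have hct : Tendsto c atTop (𝓝 0) := tendsto_one_div_add_atTop_nhds_zero_nat
  have hZlim : ∀ᵐ x, Tendsto (fun k ↦ Z k x) atTop (𝓝 (w x)) := by
    filter_upwards [ae_tendsto_mollify hwl] with x hx
    have h1 : Tendsto (fun k ↦ ζ k x) atTop (𝓝 1) := by
      have h2 : Tendsto (fun k ↦ c k • x) atTop (𝓝 (0 : EuclideanSpace ℝ (Fin n))) := by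
        simpa using hct.smul_const x
      have h3 := (χ.continuous.tendsto 0).comp h2
      rwa [χ.one_of_mem_closedBall (by simp [χ])] at h3
    simpa using h1.mul hx
  have hfin := Lp.eLpNorm_lim_le_liminf_eLpNorm (p := p')
    (fun k ↦ (hZs k).continuous.aestronglyMeasurable (μ := volume)) w hZlim
  refine hfin.trans ?_
  have hlim : Tendsto (fun k ↦ C * (eLpNorm g 2 volume +
      ENNReal.ofReal (M * c k) * eLpNorm w 2 volume)) atTop (𝓝 (C * eLpNorm g 2 volume)) := by
    refine ENNReal.Tendsto.const_mul ?_ (Or.inr (by finiteness))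
    have h1 : Tendsto (fun k ↦ ENNReal.ofReal (M * c k)) atTop (𝓝 0) := by
      have := ENNReal.tendsto_ofReal (hct.const_mul M)
      simpa using this
    have h2 := ENNReal.Tendsto.mul_const (b := eLpNorm w 2 volume) h1 (Or.inr h.memLp.2.ne)
    simpa using h2.const_add (eLpNorm g 2 volume)
  exact (liminf_le_liminf (Eventually.of_forall hZbound)).trans hlim.liminf_eq.le

theorem tendsto_integral_mul_of_tendsto_eLpNorm {X : Type*} [MeasurableSpace X] {μ : Measure X}
    {f : ℕ → X → ℝ} {g h : X → ℝ} (hf : ∀ k, MemLp (f k) 2 μ) (hg : MemLp g 2 μ)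
    (hh : MemLp h 2 μ) (hlim : Tendsto (fun k ↦ eLpNorm (f k - g) 2 μ) atTop (𝓝 0)) :
    Tendsto (fun k ↦ ∫ x, f k x * h x ∂μ) atTop (𝓝 (∫ x, g x * h x ∂μ)) := by
  refine tendsto_integral_of_L1' _ (hg.integrable_mul hh).1
    (Eventually.of_forall fun k ↦ (hf k).integrable_mul hh) ?_
  refine tendsto_of_tendsto_of_tendsto_of_le_of_le tendsto_const_nhds
    (h := fun k ↦ eLpNorm (f k - g) 2 μ * eLpNorm h 2 μ) ?_ (fun _ ↦ zero_le) fun k ↦ ?_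
  · simpa using ENNReal.Tendsto.mul_const hlim (Or.inr hh.2.ne)
  · have := eLpNorm_smul_le_mul_eLpNorm (p := 2) (q := 2) (r := 1) hh.1 ((hf k).sub hg).1
    refine le_trans (le_of_eq ?_) this
    congr 1
    ext x
    simp [sub_mul]

/-- The chain rule in `H¹(ℝⁿ)` for a `C¹` function `Θ` with bounded derivative and `Θ 0 = 0`. -/
theorem MemH1With.comp_of_deriv_le {u : EuclideanSpace ℝ (Fin n) → ℝ}
    {g : EuclideanSpace ℝ (Fin n) → EuclideanSpace ℝ (Fin n)} (h : MemH1With u g) {Θ Θ' : ℝ → ℝ}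
    (hΘ : ∀ t, HasDerivAt Θ (Θ' t) t) (hΘ' : Continuous Θ') (h0 : Θ 0 = 0) {K : ℝ}
    (hK : ∀ t, |Θ' t| ≤ K) : MemH1With (fun x ↦ Θ (u x)) (fun x ↦ Θ' (u x) • g x) := by
  have hΘc : Continuous Θ := continuous_iff_continuousAt.2 fun t ↦ (hΘ t).continuousAt
  have hΘC : ContDiff ℝ 1 Θ := by
    rw [contDiff_one_iff_deriv]
    refine ⟨fun t ↦ (hΘ t).differentiableAt, ?_⟩
    rwa [show deriv Θ = Θ' from funext fun t ↦ (hΘ t).deriv]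
  have hLip : ∀ s t, |Θ s - Θ t| ≤ K * |s - t| := fun s t ↦
    Convex.norm_image_sub_le_of_norm_hasDerivWithin_le (s := univ)
      (fun t _ ↦ (hΘ t).hasDerivWithinAt) (fun t _ ↦ hK t) convex_univ (mem_univ _) (mem_univ _)
  have hcomp : ∀ {v : EuclideanSpace ℝ (Fin n) → ℝ}, MemLp v 2 → MemLp (fun x ↦ Θ (v x)) 2 := by
    intro v hv
    refine hv.of_le_mul (c := K) (hΘc.comp_aestronglyMeasurable hv.1)
      (Eventually.of_forall fun x ↦ ?_)
    simpa [h0] using hLip (v x) 0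
  have hmul : ∀ {v f : EuclideanSpace ℝ (Fin n) → ℝ}, AEStronglyMeasurable v → MemLp f 2 →
      MemLp (fun x ↦ Θ' (v x) * f x) 2 := by
    intro v f hv hf
    refine hf.of_le_mul (c := K) ((hΘ'.comp_aestronglyMeasurable hv).mul hf.1)
      (Eventually.of_forall fun x ↦ ?_)
    rw [norm_mul]
    exact mul_le_mul_of_nonneg_right (hK _) (norm_nonneg _)
  have hcoord : ∀ {f : EuclideanSpace ℝ (Fin n) → EuclideanSpace ℝ (Fin n)} (i : Fin n),
      MemLp f 2 → MemLp (fun x ↦ f x i) 2 := by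
    intro f i hf
    refine hf.of_le_mul (c := 1)
      ((EuclideanSpace.proj i : EuclideanSpace ℝ (Fin n) →L[ℝ] ℝ).continuous
        |>.comp_aestronglyMeasurable hf.1) (Eventually.of_forall fun x ↦ ?_)
    rw [one_mul]
    exact PiLp.norm_apply_le _ _
  have hmem : MemLp (fun x ↦ Θ (u x)) 2 := hcomp h.memLp
  have hmemg : MemLp (fun x ↦ Θ' (u x) • g x) 2 := by
    refine h.memLp_grad.of_le_mul (c := K)
      ((hΘ'.comp_aestronglyMeasurable h.memLp.1).smul h.memLp_grad.1)
      (Eventually.of_forall fun x ↦ ?_)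
    rw [norm_smul]
    exact mul_le_mul_of_nonneg_right (hK _) (norm_nonneg _)
  refine ⟨hmem, hmemg, hmem.locallyIntegrable (by norm_num), hmemg.locallyIntegrable (by norm_num),
    fun ψ hψ hψc i ↦ ?_⟩
  have hul := h.memLp.locallyIntegrable (by norm_num)
  have hgl := h.memLp_grad.locallyIntegrable (by norm_num)
  have hψm : MemLp ψ 2 := hψ.continuous.memLp_of_hasCompactSupport hψc
  have hdc : Continuous fun x ↦ fderiv ℝ ψ x (EuclideanSpace.single i 1) :=
    (hψ.continuous_fderiv (by simp)).clm_apply continuous_const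
  have hdm : MemLp (fun x ↦ fderiv ℝ ψ x (EuclideanSpace.single i 1)) 2 :=
    hdc.memLp_of_hasCompactSupport (hψc.fderiv_apply ℝ _)
  set U := fun k ↦ mollify k u with hU
  set G := fun k ↦ mollify k g with hG
  have hUm : ∀ k, MemLp (U k) 2 := memLp_mollify h.memLp
  have hGm : ∀ k, MemLp (G k) 2 := memLp_mollify h.memLp_grad
  have hUs : ∀ k, ContDiff ℝ 1 (U k) := contDiff_mollify hul
  have hUd : ∀ k x, fderiv ℝ (fun x ↦ Θ (U k x)) x (EuclideanSpace.single i 1) =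
      Θ' (U k x) * G k x i := by
    intro k x
    have h1 : HasFDerivAt (fun x ↦ Θ (U k x)) (Θ' (U k x) • fderiv ℝ (U k) x) x :=
      (hΘ (U k x)).comp_hasFDerivAt x
        ((hUs k).differentiable (by simp)).differentiableAt.hasFDerivAt
    rw [h1.fderiv, smul_apply, h.hasWeakGradient.fderiv_mollify,
      innerSL_apply_apply, EuclideanSpace.inner_single_right]
    simp [hG]
  -- Integration by parts for the smooth approximations.
  have hibp : ∀ k, ∫ x, Θ (U k x) * fderiv ℝ ψ x (EuclideanSpace.single i 1) =
      -∫ x, (Θ' (U k x) * G k x i) * ψ x := by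
    intro k
    have h2 := hmul (hUm k).1 (hcoord i (hGm k))
    have := integral_mul_fderiv_eq_neg_fderiv_mul_of_integrable (μ := volume)
      (f := fun x ↦ Θ (U k x)) (g := ψ) (v := EuclideanSpace.single i (1 : ℝ))
      (by simp only [hUd]; exact h2.integrable_mul hψm) ((hcomp (hUm k)).integrable_mul hdm)
      ((hcomp (hUm k)).integrable_mul hψm)
      (fun x _ ↦ ((hΘC.comp (hUs k)).differentiable (by simp)).differentiableAt)
      (fun x _ ↦ (hψ.differentiable (by simp)).differentiableAt)
    rw [this]
    simp only [hUd]
  have hL : Tendsto (fun k ↦ ∫ x, Θ (U k x) * fderiv ℝ ψ x (EuclideanSpace.single i 1)) atTop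
      (𝓝 (∫ x, Θ (u x) * fderiv ℝ ψ x (EuclideanSpace.single i 1))) := by
    refine tendsto_integral_mul_of_tendsto_eLpNorm (fun k ↦ hcomp (hUm k)) hmem hdm ?_
    refine tendsto_of_tendsto_of_tendsto_of_le_of_le tendsto_const_nhds
      (h := fun k ↦ ENNReal.ofReal K * eLpNorm (U k - u) 2 volume) ?_ (fun _ ↦ zero_le) fun k ↦ ?_
    · simpa using ENNReal.Tendsto.const_mul (tendsto_eLpNorm_mollify_sub h.memLp)
        (Or.inr ENNReal.ofReal_ne_top)
    · exact eLpNorm_le_mul_eLpNorm_of_ae_le_mul (Eventually.of_forall fun x ↦ hLip _ _) 2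
  have hR : Tendsto (fun k ↦ ∫ x, (Θ' (U k x) * G k x i) * ψ x) atTop
      (𝓝 (∫ x, (Θ' (u x) * g x i) * ψ x)) := by
    have hgi := hcoord i h.memLp_grad
    have h1 : Tendsto (fun k ↦ ∫ x, (Θ' (U k x) * (G k x i - g x i)) * ψ x) atTop (𝓝 0) := by
      have hm : ∀ k, MemLp (fun x ↦ Θ' (U k x) * (G k x i - g x i)) 2 := fun k ↦
        hmul (hUm k).1 ((hcoord i (hGm k)).sub hgi)
      have := tendsto_integral_mul_of_tendsto_eLpNorm (g := 0) hm MemLp.zero hψm ?_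
      · simpa using this
      refine tendsto_of_tendsto_of_tendsto_of_le_of_le tendsto_const_nhds
        (h := fun k ↦ ENNReal.ofReal K * eLpNorm (G k - g) 2 volume) ?_ (fun _ ↦ zero_le)
        fun k ↦ ?_
      · simpa using ENNReal.Tendsto.const_mul (tendsto_eLpNorm_mollify_sub h.memLp_grad)
          (Or.inr ENNReal.ofReal_ne_top)
      · refine eLpNorm_le_mul_eLpNorm_of_ae_le_mul (Eventually.of_forall fun x ↦ ?_) 2
        simp only [Pi.sub_apply, Pi.zero_apply, sub_zero]
        rw [norm_mul]
        exact mul_le_mul (hK _) (PiLp.norm_apply_le (G k x - g x) i) (norm_nonneg _)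
          ((abs_nonneg _).trans (hK 0))
    have h2 : Tendsto (fun k ↦ ∫ x, (Θ' (U k x) * g x i) * ψ x) atTop
        (𝓝 (∫ x, (Θ' (u x) * g x i) * ψ x)) := by
      refine tendsto_integral_of_dominated_convergence (fun x ↦ K * ‖g x i * ψ x‖)
        (fun k ↦ ((hmul (hUm k).1 hgi).integrable_mul hψm).1)
        ((hgi.integrable_mul hψm).norm.const_mul K) (fun k ↦ Eventually.of_forall fun x ↦ ?_) ?_
      · rw [mul_assoc, norm_mul]
        exact mul_le_mul_of_nonneg_right (hK _) (norm_nonneg _)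
      · filter_upwards [ae_tendsto_mollify hul] with x hx
        exact (((hΘ'.tendsto _).comp hx).mul_const _).mul_const _
    have h3 := h1.add h2
    rw [zero_add] at h3
    refine h3.congr fun k ↦ ?_
    rw [← integral_add]
    · refine integral_congr_ae (Eventually.of_forall fun x ↦ ?_)
      simp only
      ring
    · exact (hmul (hUm k).1 ((hcoord i (hGm k)).sub hgi)).integrable_mul hψm
    · exact (hmul (hUm k).1 hgi).integrable_mul hψm
  have := tendsto_nhds_unique hL (hR.neg.congr fun k ↦ (hibp k).symm)
  simpa using this

end Gradient

/-! ### Riesz energies and potentials -/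

section RieszEnergy

variable {E : Type*} [NormedAddCommGroup E] [MeasurableSpace E] {μ : Measure E} {l : ℝ}
  {F F' G G' : E → ℝ≥0∞}

theorem rieszEnergy_mono (hF : ∀ x, F x ≤ F' x) (hG : ∀ x, G x ≤ G' x) :
    rieszEnergy μ l F G ≤ rieszEnergy μ l F' G' :=
  lintegral_mono fun x ↦ mul_le_mul' (hF x) (lintegral_mono fun y ↦ mul_le_mul_right (hG y) _)

theorem measurable_lintegral_norm_rpow_mul [BorelSpace E] [SecondCountableTopology E] [SFinite μ]
    (hG : Measurable G) : Measurable fun x ↦ ∫⁻ y, ENNReal.ofReal (‖x - y‖ ^ (-l)) * G y ∂μ := by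
  have hm : Measurable fun z : E × E ↦ ENNReal.ofReal (‖z.1 - z.2‖ ^ (-l)) * G z.2 := by fun_prop
  exact hm.lintegral_prod_right'

theorem rieszEnergy_add_left [BorelSpace E] [SecondCountableTopology E] [SFinite μ]
    (hF : Measurable F) (hG : Measurable G) :
    rieszEnergy μ l (fun x ↦ F x + F' x) G = rieszEnergy μ l F G + rieszEnergy μ l F' G := by
  simp only [rieszEnergy, add_mul]
  exact lintegral_add_left (hF.mul (measurable_lintegral_norm_rpow_mul hG)) _

theorem rieszEnergy_add_right [BorelSpace E] [SecondCountableTopology E] [SFinite μ]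
    (hF : Measurable F) (hG : Measurable G) :
    rieszEnergy μ l F (fun x ↦ G x + G' x) = rieszEnergy μ l F G + rieszEnergy μ l F G' := by
  have h : ∀ x, ∫⁻ y, ENNReal.ofReal (‖x - y‖ ^ (-l)) * (G y + G' y) ∂μ =
      (∫⁻ y, ENNReal.ofReal (‖x - y‖ ^ (-l)) * G y ∂μ) +
        ∫⁻ y, ENNReal.ofReal (‖x - y‖ ^ (-l)) * G' y ∂μ := by
    intro x
    have hm : Measurable fun y ↦ ENNReal.ofReal (‖x - y‖ ^ (-l)) * G y := by fun_prop
    rw [← lintegral_add_left hm]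
    simp only [mul_add]
  simp only [rieszEnergy, h]
  simp only [mul_add]
  exact lintegral_add_left (hF.mul (measurable_lintegral_norm_rpow_mul hG)) _

theorem rieszEnergy_const_mul_left {c : ℝ≥0∞} (hc : c ≠ ⊤) :
    rieszEnergy μ l (fun x ↦ c * F x) G = c * rieszEnergy μ l F G := by
  simp only [rieszEnergy, mul_assoc]
  exact lintegral_const_mul' _ _ hc

theorem rieszEnergy_const_mul_right {c : ℝ≥0∞} (hc : c ≠ ⊤) :
    rieszEnergy μ l F (fun x ↦ c * G x) = c * rieszEnergy μ l F G := by
  simp only [rieszEnergy, mul_left_comm _ c]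
  simp only [lintegral_const_mul' _ _ hc, mul_left_comm _ c]

end RieszEnergy

section Estimates

variable {n : ℕ} {α : ℝ}

theorem lintegral_mul_rpow_rpow_le {X : Type*} [MeasurableSpace X] {μ : Measure X} {c e σ θ : ℝ}
    (he : 0 < e) (hσ : 0 < σ) (hθ : 0 < θ) (hc : 1 / c = 1 / e + θ / σ) {h w : X → ℝ≥0∞}
    (hh : Measurable h) (hw : Measurable w) :
    (∫⁻ x, (h x * w x ^ θ) ^ c ∂μ) ^ (1 / c) ≤
      (∫⁻ x, h x ^ e ∂μ) ^ (1 / e) * (∫⁻ x, w x ^ σ ∂μ) ^ (θ / σ) := by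
  have hc0 : 0 < 1 / c := by rw [hc]; positivity
  have hc0' : 0 < c := one_div_pos.1 hc0
  have hce : c < e := by
    have : 1 / e < 1 / c := by rw [hc]; linarith [div_pos hθ hσ]
    exact (one_div_lt_one_div he hc0').1 this
  have := ENNReal.lintegral_Lp_mul_le_Lq_mul_Lr hc0' hce (r := σ / θ)
    (by rw [hc, one_div_div]) μ hh.aemeasurable (hw.pow_const θ).aemeasurable
  simp only [Pi.mul_apply, ← ENNReal.rpow_mul, one_div_div] at this
  rwa [mul_div_cancel₀ _ hθ.ne'] at this

/-- The Hardy–Littlewood–Sobolev inequality combined with Hölder's inequality: for `h` in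
`L^{2n/(α+2)}` and `w` in the critical Lebesgue space, the powers `2 - θ` and `θ` of `w` may be
distributed over the two factors as long as both exponents stay above `1`. -/
theorem exists_rieszEnergy_mul_rpow_le (hn : 3 ≤ n) (hα : α ∈ Ioo (0 : ℝ) n) {θ : ℝ}
    (hθ0 : 0 < θ) (hθ1 : θ ≤ 1) (hθ : (1 - θ) * (n - 2) < n - α) :
    ∃ C : ℝ≥0∞, C ≠ ⊤ ∧ ∀ h w : EuclideanSpace ℝ (Fin n) → ℝ≥0∞, (∀ x, h x ≠ ⊤) →
      (∀ x, w x ≠ ⊤) → Measurable h → Measurable w →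
      rieszEnergy volume (n - α) (fun x ↦ h x * w x ^ (2 - θ)) (fun x ↦ h x * w x ^ θ) ≤
        C * ((∫⁻ x, h x ^ (2 * n / (α + 2))) ^ ((α + 2) / n) *
          (∫⁻ x, w x ^ (2 * (n : ℝ) / (n - 2))) ^ (((n : ℝ) - 2) / n)) := by
  obtain ⟨hα0, hαn⟩ := hα
  have hn' : (3 : ℝ) ≤ n := by exact_mod_cast hn
  have hn2 : (0 : ℝ) < n - 2 := by linarith
  have hn0 : (0 : ℝ) < n := by linarith
  have hθn : 0 < θ * (n - 2) := by positivity
  have hθn' : 0 < (2 - θ) * (n - 2) := mul_pos (by linarith) hn2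
  set a : ℝ := 2 * n / (α + 2 + θ * (n - 2)) with ha
  set b : ℝ := 2 * n / (α + 2 + (2 - θ) * (n - 2)) with hb
  have ha1 : 1 < a := by
    rw [ha, one_lt_div (by positivity)]
    nlinarith
  have hb1 : 1 < b := by
    rw [hb, one_lt_div (by positivity)]
    nlinarith
  have hσ : (0 : ℝ) < 2 * n / (n - 2) := by positivity
  obtain ⟨C, hC, H⟩ := exists_rieszEnergy_le
    (volume : Measure (EuclideanSpace ℝ (Fin n))) hb1 ha1 (l := n - α) (by linarith)
    (by rw [finrank_euclideanSpace_fin]; linarith) (by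
      rw [finrank_euclideanSpace_fin, ha, hb, one_div_div, one_div_div]
      field_simp
      ring)
  refine ⟨C, hC, fun h w hht hw_t hh hw ↦ ?_⟩
  refine (H _ _ (fun x ↦ ENNReal.mul_ne_top (hht x)
    (ENNReal.rpow_ne_top_of_nonneg (by linarith) (hw_t x)))
    (fun x ↦ ENNReal.mul_ne_top (hht x) (ENNReal.rpow_ne_top_of_nonneg hθ0.le (hw_t x)))
    (by fun_prop) (by fun_prop)).trans ?_
  refine mul_le_mul' le_rfl ?_
  refine (mul_le_mul' (lintegral_mul_rpow_rpow_le (θ := 2 - θ) (e := 2 * n / (α + 2))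
    (by positivity) hσ (by linarith) ?_ hh hw)
    (lintegral_mul_rpow_rpow_le (e := 2 * n / (α + 2)) (by positivity) hσ
    hθ0 ?_ hh hw)).trans_eq ?_
  · rw [hb, one_div_div, one_div_div]; field_simp
  · rw [ha, one_div_div, one_div_div]; field_simp
  · rw [mul_mul_mul_comm, ← ENNReal.rpow_add_of_nonneg _ _ (by positivity) (by positivity),
      ← ENNReal.rpow_add_of_nonneg _ _ (by apply div_nonneg _ hσ.le; linarith) (by positivity)]
    congr 2
    · rw [one_div_div]; field_simp; ring
    · field_simp; ring

/-- If `f` is bounded and square integrable, then the Riesz potential of `f ^ p` is bounded. -/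
theorem exists_lintegral_norm_rpow_mul_le (hn : 3 ≤ n) (hα : α ∈ Ioo (0 : ℝ) n) {p : ℝ}
    (hp : ((n : ℝ) + α) / n ≤ p) {f : EuclideanSpace ℝ (Fin n) → ℝ} (hf0 : ∀ x, 0 ≤ f x)
    (hf : Measurable f) (h2 : ∫⁻ x, ENNReal.ofReal (f x) ^ (2 : ℝ) ≠ ⊤) {M : ℝ} (hM : 0 < M)
    (hfM : ∀ x, f x ≤ M) :
    ∃ C : ℝ≥0∞, C ≠ ⊤ ∧ ∀ x, ∫⁻ y, ENNReal.ofReal (‖x - y‖ ^ (-((n : ℝ) - α))) *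
      ENNReal.ofReal (f y ^ p) ≤ C := by
  obtain ⟨hα0, hαn⟩ := hα
  have hn' : (3 : ℝ) ≤ n := by exact_mod_cast hn
  have hn0 : (0 : ℝ) < n := by linarith
  have hp1 : 1 < p := lt_of_lt_of_le (by rw [one_lt_div hn0]; linarith) hp
  have hp0 : 0 < p := by linarith
  have hpn : n + α ≤ p * n := (div_le_iff₀ hn0).1 hp
  obtain ⟨C, hC, hker⟩ := exists_setLIntegral_norm_rpow_le
    (volume : Measure (EuclideanSpace ℝ (Fin n))) (l := n - α) (by linarith)
    (by rw [finrank_euclideanSpace_fin]; linarith)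
  rw [finrank_euclideanSpace_fin] at hker
  have hexp : 1 - ((n : ℝ) - α) / n = α / n := by field_simp; ring
  rw [hexp] at hker
  set N := ∫⁻ x, ENNReal.ofReal (f x) ^ (2 : ℝ) with hN
  have he : -1 < -(2 * α / (p * n)) := by
    rw [neg_lt_neg_iff, div_lt_one (by positivity)]
    linarith
  have hset : ∀ s : ℝ, 0 < s → volume {y | s < f y ^ p} ≤ ENNReal.ofReal (s ^ (-(2 / p))) * N := by
    intro s hs
    have h1 : {y | s < f y ^ p} ⊆
        {y | ENNReal.ofReal (s ^ (2 / p)) ≤ ENNReal.ofReal (f y) ^ (2 : ℝ)} := by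
      intro y hy
      simp only [mem_ofPred_eq] at hy ⊢
      rw [ENNReal.ofReal_rpow_of_nonneg (hf0 y) (by norm_num)]
      refine ENNReal.ofReal_le_ofReal ?_
      have := Real.rpow_le_rpow hs.le hy.le (z := 2 / p) (by positivity)
      rwa [← Real.rpow_mul (hf0 y), mul_div_cancel₀ _ hp0.ne'] at this
    refine (measure_mono h1).trans ?_
    have h3 := meas_ge_le_lintegral_div (μ := volume) (f := fun y ↦ ENNReal.ofReal (f y) ^ (2 : ℝ))
      (by fun_prop) (ε := ENNReal.ofReal (s ^ (2 / p))) (by simp; positivity) (by simp)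
    refine h3.trans_eq ?_
    rw [Real.rpow_neg hs.le, ENNReal.ofReal_inv_of_pos (by positivity), div_eq_mul_inv, mul_comm]
  refine ⟨C * N ^ (α / n) * ∫⁻ s in Ioc 0 (M ^ p), ENNReal.ofReal (s ^ (-(2 * α / (p * n)))), ?_,
    fun x ↦ ?_⟩
  · rw [setLIntegral_Ioc_rpow he (by positivity)]
    have : N ^ (α / n) ≠ ⊤ := ENNReal.rpow_ne_top_of_nonneg (by positivity) h2
    finiteness
  · calc ∫⁻ y, ENNReal.ofReal (‖x - y‖ ^ (-((n : ℝ) - α))) * ENNReal.ofReal (f y ^ p)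
        = ∫⁻ s in Ioi (0 : ℝ), ∫⁻ y in {y | s < f y ^ p},
            ENNReal.ofReal (‖x - y‖ ^ (-((n : ℝ) - α))) := by
          simp only [mul_comm (ENNReal.ofReal (‖x - _‖ ^ (-((n : ℝ) - α))))]
          exact lintegral_ofReal_mul_eq_lintegral_setLIntegral
            (fun y ↦ Real.rpow_nonneg (hf0 y) _) (by fun_prop) (by fun_prop)
      _ ≤ ∫⁻ s in Ioi (0 : ℝ), (Ioc 0 (M ^ p)).indicator
            (fun s ↦ C * N ^ (α / n) * ENNReal.ofReal (s ^ (-(2 * α / (p * n))))) s := by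
          refine setLIntegral_mono' measurableSet_Ioi fun s hs ↦ ?_
          have hs0 : 0 < s := hs
          by_cases hsM : s ≤ M ^ p
          · rw [indicator_of_mem (show s ∈ Ioc 0 (M ^ p) from ⟨hs0, hsM⟩)]
            refine (hker _ x).trans ?_
            rw [mul_assoc]
            gcongr
            refine (ENNReal.rpow_le_rpow (hset s hs0) (by positivity)).trans_eq ?_
            rw [ENNReal.mul_rpow_of_nonneg _ _ (by positivity), mul_comm,
              ENNReal.ofReal_rpow_of_pos (by positivity), ← Real.rpow_mul hs0.le]
            congr 3
            field_simp
          · have : {y | s < f y ^ p} = ∅ := by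
              rw [eq_empty_iff_forall_notMem]
              intro y hy
              exact hsM (hy.le.trans (Real.rpow_le_rpow (hf0 y) (hfM y) hp0.le))
            simp [this]
      _ ≤ _ := by
          rw [lintegral_indicator measurableSet_Ioc, Measure.restrict_restrict measurableSet_Ioc,
            inter_eq_self_of_subset_left Ioc_subset_Ioi_self, lintegral_const_mul _ (by fun_prop)]

end Estimates

/-! ### The a priori estimate for truncated powers -/

section Truncation

variable {n : ℕ} {α p r : ℝ}

theorem tendsto_setLIntegral_lt_atTop {X : Type*} [MeasurableSpace X] {μ : Measure X}
    {f : X → ℝ} (hf : Measurable f) {φ : X → ℝ≥0∞} (hφ : ∫⁻ x, φ x ∂μ ≠ ⊤) :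
    Tendsto (fun M : ℝ ↦ ∫⁻ x in {x | M < f x}, φ x ∂μ) atTop (𝓝 0) := by
  have hm : ∀ M : ℝ, MeasurableSet {x | M < f x} := fun M ↦ measurableSet_lt measurable_const hf
  have h := tendsto_measure_iInter_atTop (μ := μ.withDensity φ) (s := fun M : ℝ ↦ {x | M < f x})
    (fun M ↦ (hm M).nullMeasurableSet) (fun M M' hMM x (hx : M' < f x) ↦ hMM.trans_lt hx)
    ⟨0, by
      rw [withDensity_apply _ (hm 0)]
      exact ((setLIntegral_le_lintegral _ _).trans_lt hφ.lt_top).ne⟩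
  have he : ⋂ M : ℝ, {x | M < f x} = ∅ := by
    rw [eq_empty_iff_forall_notMem]
    intro x hx
    exact lt_irrefl (f x) (mem_iInter.1 hx (f x))
  rw [he, measure_empty] at h
  exact h.congr fun M ↦ withDensity_apply _ (hm M)

theorem mul_rpow_min_rpow_two_div_le {t L : ℝ} (ht : 0 < t) (hL : 0 < L) (hr : 2 ≤ r) :
    (t * min t L ^ ((r - 2) / 2)) ^ (2 / r) ≤ t := by
  have hm : 0 < min t L := lt_min ht hL
  have hr0 : 0 < r := by linarith
  have h1 : t * min t L ^ ((r - 2) / 2) ≤ t ^ (r / 2) := by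
    calc t * min t L ^ ((r - 2) / 2) ≤ t * t ^ ((r - 2) / 2) := by
          gcongr
          exact min_le_left _ _
      _ = t ^ (r / 2) := by
          rw [← Real.rpow_one_add' ht.le (by linarith)]
          congr 1; ring
  calc _ ≤ (t ^ (r / 2)) ^ (2 / r) := by gcongr
    _ = t := by
        rw [← Real.rpow_mul ht.le, show r / 2 * (2 / r) = 1 by field_simp, Real.rpow_one]

theorem mul_rpow_min_rpow_two {t L : ℝ} (ht : 0 ≤ t) (hL : 0 < L) (a : ℝ) :
    (t * min t L ^ (a / 2)) ^ (2 : ℝ) = t ^ (2 : ℝ) * min t L ^ a := by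
  have hm : 0 ≤ min t L := le_min ht hL.le
  rw [Real.mul_rpow ht (by positivity), ← Real.rpow_mul hm, div_mul_cancel₀ _ two_ne_zero]

/-- On the set where `f` is large, the nonlinearity is controlled by the critical power; the factor
`f ^ (q - 1)` with `q = (n + α) / (n - 2)` is small in its Lebesgue space. The part of the right
factor with `f ≤ L` is handled by `2 / r` powers of `f * min f L ^ ((r - 2) / 2)`; on `f > L` the
truncation makes the two factors comparable after moving `L ^ ((r - 2) / 2)` across. -/
theorem exists_rieszEnergy_indicator_le (hn : 3 ≤ n) (hα : α ∈ Ioo (0 : ℝ) n)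
    (hp : p ≤ ((n : ℝ) + α) / (n - 2)) (hr : r ∈ Ico 2 (2 * n / α)) :
    ∃ C : ℝ≥0∞, C ≠ ⊤ ∧ ∀ f : EuclideanSpace ℝ (Fin n) → ℝ, (∀ x, 0 ≤ f x) → Measurable f →
      ∀ M : ℝ, 1 ≤ M → ∀ L : ℝ, 0 < L →
      rieszEnergy volume (n - α)
        ({x | M < f x}.indicator fun x ↦ ENNReal.ofReal (f x ^ p * min (f x) L ^ (r - 2)))
        ({x | M < f x}.indicator fun x ↦ ENNReal.ofReal (f x ^ p)) ≤
      C * ((∫⁻ x in {x | M < f x}, ENNReal.ofReal (f x) ^ (2 * (n : ℝ) / (n - 2))) ^ ((α + 2) / n) *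
        (∫⁻ x, ENNReal.ofReal (f x * min (f x) L ^ ((r - 2) / 2)) ^ (2 * (n : ℝ) / (n - 2))) ^
          (((n : ℝ) - 2) / n)) := by
  have hn' : (3 : ℝ) ≤ n := by exact_mod_cast hn
  have hn2 : (0 : ℝ) < n - 2 := by linarith
  have hn0 : (0 : ℝ) < n := by linarith
  have hα0 := hα.1
  have hαn := hα.2
  obtain ⟨hr2, hrα⟩ := hr
  have hr0 : 0 < r := by linarith
  have hθ : (1 - 2 / r) * (n - 2) < n - α := by
    have h1 : α / n < 2 / r := by
      rw [div_lt_div_iff₀ hn0 hr0]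
      rw [lt_div_iff₀ hα0] at hrα
      linarith
    have h2 : 2 / r ≤ 1 := (div_le_one hr0).2 hr2
    have h3 : (1 - 2 / r) * n < n - α := by
      have := mul_lt_mul_of_pos_right h1 hn0
      rw [div_mul_cancel₀ _ hn0.ne'] at this
      linarith
    nlinarith
  obtain ⟨C₁, hC₁, H₁⟩ := exists_rieszEnergy_mul_rpow_le hn hα (θ := 2 / r) (by positivity)
    ((div_le_one hr0).2 hr2) hθ
  obtain ⟨C₂, hC₂, H₂⟩ := exists_rieszEnergy_mul_rpow_le hn hα (θ := 1) one_pos le_rfl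
    (by linarith)
  refine ⟨C₁ + C₂, by finiteness, fun f hf0 hf M hM L hL ↦ ?_⟩
  set A := {x | M < f x} with hA
  have hAm : MeasurableSet A := measurableSet_lt measurable_const hf
  set q := ((n : ℝ) + α) / (n - 2) with hq
  have hq1 : q - 1 = (α + 2) / (n - 2) := by rw [hq]; field_simp; ring
  set h : EuclideanSpace ℝ (Fin n) → ℝ≥0∞ :=
    A.indicator fun x ↦ ENNReal.ofReal (f x ^ (q - 1)) with hh
  set w : EuclideanSpace ℝ (Fin n) → ℝ≥0∞ :=
    fun x ↦ ENNReal.ofReal (f x * min (f x) L ^ ((r - 2) / 2)) with hw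
  have hhm : Measurable h := Measurable.indicator (by fun_prop) hAm
  have hwm : Measurable w := by fun_prop
  have hht : ∀ x, h x ≠ ⊤ := fun x ↦ by
    by_cases hx : x ∈ A <;> simp [hh, hx]
  have hwt : ∀ x, w x ≠ ⊤ := fun x ↦ ENNReal.ofReal_ne_top
  have hS : ∫⁻ x, h x ^ (2 * n / (α + 2)) =
      ∫⁻ x in A, ENNReal.ofReal (f x) ^ (2 * (n : ℝ) / (n - 2)) := by
    rw [← lintegral_indicator hAm]
    refine lintegral_congr fun x ↦ ?_
    by_cases hx : x ∈ A
    · simp only [hh, indicator_of_mem hx]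
      rw [ENNReal.ofReal_rpow_of_nonneg (Real.rpow_nonneg (hf0 x) _) (by positivity),
        ENNReal.ofReal_rpow_of_nonneg (hf0 x) (by positivity), ← Real.rpow_mul (hf0 x), hq1]
      congr 2
      field_simp
    · simp only [hh, indicator_of_notMem hx]
      exact ENNReal.zero_rpow_of_pos (by positivity)
  have hcrit : ∀ x ∈ A, f x ^ p ≤ f x ^ (q - 1) * f x := by
    intro x hx
    have h1 : 1 < f x := hM.trans_lt hx
    rw [← Real.rpow_add_one (by linarith)]
    exact Real.rpow_le_rpow_of_exponent_le h1.le (by linarith)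
  have hl1 : ∀ x, A.indicator (fun x ↦ ENNReal.ofReal (f x ^ p * min (f x) L ^ (r - 2))) x ≤
      h x * w x ^ (2 - 2 / r) := by
    intro x
    by_cases hx : x ∈ A
    · have h0 : 0 < f x := by have : M < f x := hx; linarith
      have hm0 : 0 < min (f x) L := lt_min h0 hL
      simp only [hh, hw, indicator_of_mem hx]
      rw [ENNReal.ofReal_rpow_of_pos (by positivity), ← ENNReal.ofReal_mul (by positivity)]
      refine ENNReal.ofReal_le_ofReal ?_
      have e : (f x * min (f x) L ^ ((r - 2) / 2)) ^ (2 - 2 / r) =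
          f x ^ (2 : ℝ) * min (f x) L ^ (r - 2) /
            (f x * min (f x) L ^ ((r - 2) / 2)) ^ (2 / r) := by
        rw [Real.rpow_sub (by positivity) 2 (2 / r), mul_rpow_min_rpow_two h0.le hL]
      rw [e]
      calc f x ^ p * min (f x) L ^ (r - 2)
          ≤ f x ^ (q - 1) * f x * min (f x) L ^ (r - 2) := by gcongr; exact hcrit x hx
        _ = f x ^ (q - 1) * (f x ^ (2 : ℝ) * min (f x) L ^ (r - 2) / f x) := by
            rw [Real.rpow_two]; field_simp
        _ ≤ _ := by
            gcongr
            exact mul_rpow_min_rpow_two_div_le h0 hL hr2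
    · simp [hx]
  have hl2 : ∀ x, A.indicator (fun x ↦ ENNReal.ofReal (f x ^ p * min (f x) L ^ (r - 2))) x ≤
      ENNReal.ofReal (L ^ ((r - 2) / 2)) * (h x * w x) := by
    intro x
    by_cases hx : x ∈ A
    · have h0 : 0 < f x := by have : M < f x := hx; linarith
      have hm0 : 0 < min (f x) L := lt_min h0 hL
      simp only [hh, hw, indicator_of_mem hx]
      rw [← ENNReal.ofReal_mul (by positivity), ← ENNReal.ofReal_mul (by positivity)]
      refine ENNReal.ofReal_le_ofReal ?_
      have e : min (f x) L ^ (r - 2) =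
          min (f x) L ^ ((r - 2) / 2) * min (f x) L ^ ((r - 2) / 2) := by
        rw [← Real.rpow_add hm0]; congr 1; ring
      calc f x ^ p * min (f x) L ^ (r - 2)
          ≤ f x ^ (q - 1) * f x * (L ^ ((r - 2) / 2) * min (f x) L ^ ((r - 2) / 2)) := by
            rw [e]
            gcongr
            · exact hcrit x hx
            · exact min_le_right _ _
        _ = _ := by ring
    · simp [hx]
  have hr1 : ∀ x, A.indicator (fun x ↦ ENNReal.ofReal (f x ^ p)) x ≤
      h x * w x ^ (2 / r) + ENNReal.ofReal (L ^ (-((r - 2) / 2))) * (h x * w x) := by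
    intro x
    by_cases hx : x ∈ A
    · have h0 : 0 < f x := by have : M < f x := hx; linarith
      have hm0 : 0 < min (f x) L := lt_min h0 hL
      simp only [hh, hw, indicator_of_mem hx]
      rcases le_or_gt (f x) L with hxL | hxL
      · refine le_trans ?_ le_self_add
        rw [ENNReal.ofReal_rpow_of_pos (by positivity), ← ENNReal.ofReal_mul (by positivity)]
        refine ENNReal.ofReal_le_ofReal ((hcrit x hx).trans (le_of_eq ?_))
        rw [min_eq_left hxL]
        congr 1
        rw [← Real.rpow_one_add' h0.le (by linarith), ← Real.rpow_mul h0.le,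
          show (1 + (r - 2) / 2) * (2 / r) = 1 by field_simp; ring, Real.rpow_one]
      · refine le_trans ?_ le_add_self
        rw [← ENNReal.ofReal_mul (by positivity), ← ENNReal.ofReal_mul (by positivity)]
        refine ENNReal.ofReal_le_ofReal ((hcrit x hx).trans (le_of_eq ?_))
        rw [min_eq_right hxL.le, Real.rpow_neg hL.le]
        field_simp
    · simp [hx]
  have hB : ∀ x, h x * w x = h x * w x ^ (1 : ℝ) := fun x ↦ by rw [ENNReal.rpow_one]
  have hLL : ENNReal.ofReal (L ^ ((r - 2) / 2)) * ENNReal.ofReal (L ^ (-((r - 2) / 2))) = 1 := by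
    rw [← ENNReal.ofReal_mul (by positivity), ← Real.rpow_add hL, add_neg_cancel, Real.rpow_zero,
      ENNReal.ofReal_one]
  set Gt := A.indicator (fun x ↦ ENNReal.ofReal (f x ^ p * min (f x) L ^ (r - 2))) with hGt
  have hGm : Measurable Gt := Measurable.indicator (by fun_prop) hAm
  have K₁ := H₁ h w hht hwt hhm hwm
  have K₂ := H₂ h w hht hwt hhm hwm
  rw [hS] at K₁ K₂
  rw [show (2 : ℝ) - 1 = 1 by norm_num] at K₂
  simp only [← hB] at K₂
  calc rieszEnergy volume (n - α) Gt (A.indicator fun x ↦ ENNReal.ofReal (f x ^ p))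
      ≤ rieszEnergy volume (n - α) Gt (fun x ↦ h x * w x ^ (2 / r) +
          ENNReal.ofReal (L ^ (-((r - 2) / 2))) * (h x * w x)) :=
        rieszEnergy_mono (fun _ ↦ le_rfl) hr1
    _ = rieszEnergy volume (n - α) Gt (fun x ↦ h x * w x ^ (2 / r)) +
          rieszEnergy volume (n - α) Gt
            (fun x ↦ ENNReal.ofReal (L ^ (-((r - 2) / 2))) * (h x * w x)) :=
        rieszEnergy_add_right hGm (by fun_prop)
    _ ≤ rieszEnergy volume (n - α) (fun x ↦ h x * w x ^ (2 - 2 / r)) (fun x ↦ h x * w x ^ (2 / r)) +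
          rieszEnergy volume (n - α) (fun x ↦ ENNReal.ofReal (L ^ ((r - 2) / 2)) * (h x * w x))
            (fun x ↦ ENNReal.ofReal (L ^ (-((r - 2) / 2))) * (h x * w x)) :=
        add_le_add (rieszEnergy_mono hl1 fun _ ↦ le_rfl) (rieszEnergy_mono hl2 fun _ ↦ le_rfl)
    _ ≤ _ := by
        rw [rieszEnergy_const_mul_left ENNReal.ofReal_ne_top,
          rieszEnergy_const_mul_right ENNReal.ofReal_ne_top, ← mul_assoc, hLL, one_mul, add_mul]
        exact add_le_add K₁ K₂

/-- Up to the endpoint, `p - 2 < 4 / (n - 2)` because `α < n`. -/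
theorem exists_rpow_sub_two_le (hn : 3 ≤ n) (hα : α < n) (hp : p ≤ ((n : ℝ) + α) / (n - 2))
    {δ : ℝ} (hδ : 0 < δ) :
    ∃ K : ℝ, 0 ≤ K ∧ ∀ t : ℝ, 1 ≤ t → t ^ (p - 2) ≤ K + δ * t ^ (4 / ((n : ℝ) - 2)) := by
  have hn' : (3 : ℝ) ≤ n := by exact_mod_cast hn
  have hn2 : (0 : ℝ) < n - 2 := by linarith
  set η := 4 / ((n : ℝ) - 2) with hη
  have hη0 : 0 < η := by positivity
  set κ := max (p - 2) 0 with hκ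
  have hκη : κ < η := by
    rw [hκ, max_lt_iff]
    refine ⟨?_, hη0⟩
    have : ((n : ℝ) + α) / (n - 2) < η + 2 := by
      rw [hη, div_lt_iff₀ hn2]
      field_simp
      linarith
    linarith
  obtain ⟨T, hT⟩ :=
    ((tendsto_rpow_neg_atTop (sub_pos.2 hκη)).eventually_le_const hδ).exists_forall_of_atTop
  have hT1 : (0 : ℝ) ≤ max T 1 := by positivity
  refine ⟨max T 1 ^ κ, by positivity, fun t ht ↦ ?_⟩
  have ht0 : 0 < t := by linarith
  have h1 : t ^ (p - 2) ≤ t ^ κ := Real.rpow_le_rpow_of_exponent_le ht (le_max_left _ _)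
  refine h1.trans ?_
  rcases le_total t T with h | h
  · have h2 : t ^ κ ≤ max T 1 ^ κ :=
      Real.rpow_le_rpow ht0.le (h.trans (le_max_left _ _)) (le_max_right _ _)
    have : 0 ≤ δ * t ^ η := by positivity
    linarith
  · have h2 : t ^ κ ≤ δ * t ^ η := by
      have := mul_le_mul_of_nonneg_right (hT t h) (Real.rpow_nonneg ht0.le η)
      rwa [← Real.rpow_add ht0, show -(η - κ) + η = κ by ring] at this
    have : 0 ≤ max T 1 ^ κ := by positivity
    linarith

/-- The integral of `f ^ p * min f L ^ (r - 2)` over the set where `f` is large is subcritical. -/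
theorem exists_setLIntegral_rpow_mul_min_rpow_le (hn : 3 ≤ n) (hα : α < n)
    (hp : p ≤ ((n : ℝ) + α) / (n - 2)) (hr : 2 ≤ r)
    {f : EuclideanSpace ℝ (Fin n) → ℝ} (hf0 : ∀ x, 0 ≤ f x) (hf : Measurable f)
    (hs : ∫⁻ x, ENNReal.ofReal (f x) ^ (2 * (n : ℝ) / (n - 2)) ≠ ⊤)
    (hfr : ∫⁻ x, ENNReal.ofReal (f x) ^ r ≠ ⊤) {ε : ℝ≥0∞} (hε : ε ≠ 0) :
    ∃ C : ℝ≥0∞, C ≠ ⊤ ∧ ∀ L : ℝ, 0 < L →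
      ∫⁻ x in {x | 1 < f x}, ENNReal.ofReal (f x ^ p * min (f x) L ^ (r - 2)) ≤
      C + ε * (∫⁻ x, ENNReal.ofReal (f x * min (f x) L ^ ((r - 2) / 2)) ^
        (2 * (n : ℝ) / (n - 2))) ^ (((n : ℝ) - 2) / n) := by
  have hn' : (3 : ℝ) ≤ n := by exact_mod_cast hn
  have hn2 : (0 : ℝ) < n - 2 := by linarith
  have hn0 : (0 : ℝ) < n := by linarith
  set σ := 2 * (n : ℝ) / (n - 2) with hσ
  have hσ0 : 0 < σ := by positivity
  set η := 4 / ((n : ℝ) - 2) with hη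
  set S := (∫⁻ x, ENNReal.ofReal (f x) ^ σ) ^ (2 / (n : ℝ)) with hS
  have hSt : S ≠ ⊤ := ENNReal.rpow_ne_top_of_nonneg (by positivity) hs
  obtain ⟨δ, hδ0, hδ⟩ : ∃ δ : ℝ, 0 < δ ∧ ENNReal.ofReal δ * S ≤ ε := by
    obtain ⟨d, hd0, hd⟩ := ENNReal.exists_nnreal_pos_mul_lt hSt hε
    exact ⟨d, by exact_mod_cast hd0, by rw [ENNReal.ofReal_coe_nnreal]; exact hd.le⟩
  obtain ⟨K, hK0, hK⟩ := exists_rpow_sub_two_le hn hα hp hδ0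
  refine ⟨ENNReal.ofReal K * ∫⁻ x, ENNReal.ofReal (f x) ^ r, by finiteness, fun L hL ↦ ?_⟩
  set w : EuclideanSpace ℝ (Fin n) → ℝ≥0∞ :=
    fun x ↦ ENNReal.ofReal (f x * min (f x) L ^ ((r - 2) / 2)) with hw
  have hwm : Measurable w := by fun_prop
  have hm0 : ∀ x, 0 ≤ min (f x) L := fun x ↦ le_min (hf0 x) hL.le
  have hpt : ∀ x ∈ {x | 1 < f x}, ENNReal.ofReal (f x ^ p * min (f x) L ^ (r - 2)) ≤
      ENNReal.ofReal K * ENNReal.ofReal (f x) ^ r +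
        ENNReal.ofReal δ * (ENNReal.ofReal (f x) ^ η * w x ^ (2 : ℝ)) := by
    intro x hx
    have h1 : 1 < f x := hx
    have h0 : 0 < f x := by linarith
    have hm := hm0 x
    simp only [hw]
    rw [ENNReal.ofReal_rpow_of_pos h0, ENNReal.ofReal_rpow_of_pos h0,
      ENNReal.ofReal_rpow_of_nonneg (by positivity) (by norm_num), mul_rpow_min_rpow_two h0.le hL,
      ← ENNReal.ofReal_mul (by positivity), ← ENNReal.ofReal_mul (by positivity),
      ← ENNReal.ofReal_mul (by positivity), ← ENNReal.ofReal_add (by positivity) (by positivity)]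
    refine ENNReal.ofReal_le_ofReal ?_
    have e1 : f x ^ p = f x ^ (p - 2) * f x ^ (2 : ℝ) := by
      rw [← Real.rpow_add h0]; congr 1; ring
    have e2 : f x ^ (2 : ℝ) * min (f x) L ^ (r - 2) ≤ f x ^ r := by
      calc _ ≤ f x ^ (2 : ℝ) * f x ^ (r - 2) := by
            gcongr
            exact min_le_left _ _
        _ = f x ^ r := by rw [← Real.rpow_add h0]; congr 1; ring
    calc f x ^ p * min (f x) L ^ (r - 2)
        = f x ^ (p - 2) * (f x ^ (2 : ℝ) * min (f x) L ^ (r - 2)) := by rw [e1]; ring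
      _ ≤ (K + δ * f x ^ η) * (f x ^ (2 : ℝ) * min (f x) L ^ (r - 2)) := by
          gcongr
          exact hK _ h1.le
      _ = K * (f x ^ (2 : ℝ) * min (f x) L ^ (r - 2)) +
          δ * (f x ^ η * (f x ^ (2 : ℝ) * min (f x) L ^ (r - 2))) := by ring
      _ ≤ _ := by gcongr
  have hhol : ∫⁻ x, ENNReal.ofReal (f x) ^ η * w x ^ (2 : ℝ) ≤
      S * (∫⁻ x, w x ^ σ) ^ (((n : ℝ) - 2) / n) := by
    have hconj : ((n : ℝ) / 2).HolderConjugate (n / (n - 2)) := by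
      rw [Real.holderConjugate_iff]
      refine ⟨by linarith, ?_⟩
      field_simp
      ring
    have := ENNReal.lintegral_mul_le_Lp_mul_Lq volume hconj
      (f := fun x ↦ ENNReal.ofReal (f x) ^ η) (g := fun x ↦ w x ^ (2 : ℝ)) (by fun_prop)
      (by fun_prop)
    simp only [Pi.mul_apply, ← ENNReal.rpow_mul, one_div_div] at this
    rwa [show η * (n / 2) = σ by rw [hη, hσ]; field_simp; ring,
      show 2 * ((n : ℝ) / (n - 2)) = σ by rw [hσ]; ring] at this
  calc _ ≤ ∫⁻ x in {x | 1 < f x}, (ENNReal.ofReal K * ENNReal.ofReal (f x) ^ r +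
        ENNReal.ofReal δ * (ENNReal.ofReal (f x) ^ η * w x ^ (2 : ℝ))) :=
        setLIntegral_mono (by fun_prop) hpt
    _ ≤ ∫⁻ x, (ENNReal.ofReal K * ENNReal.ofReal (f x) ^ r +
        ENNReal.ofReal δ * (ENNReal.ofReal (f x) ^ η * w x ^ (2 : ℝ))) :=
        setLIntegral_le_lintegral _ _
    _ = ENNReal.ofReal K * (∫⁻ x, ENNReal.ofReal (f x) ^ r) +
        ENNReal.ofReal δ * ∫⁻ x, ENNReal.ofReal (f x) ^ η * w x ^ (2 : ℝ) := by
        rw [lintegral_add_left (by fun_prop), lintegral_const_mul _ (by fun_prop),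
          lintegral_const_mul _ (by fun_prop)]
    _ ≤ _ := by
        refine add_le_add le_rfl ((mul_le_mul' le_rfl hhol).trans ?_)
        rw [← mul_assoc]
        exact mul_le_mul' hδ le_rfl

theorem lintegral_rpow_le_add_of_le_of_le {X : Type*} [MeasurableSpace X] {μ : Measure X}
    {f : X → ℝ≥0∞} (hf : Measurable f) {a b c : ℝ} (hab : a ≤ b) (hbc : b ≤ c) :
    ∫⁻ x, f x ^ b ∂μ ≤ (∫⁻ x, f x ^ a ∂μ) + ∫⁻ x, f x ^ c ∂μ := by
  rw [← lintegral_add_left (by fun_prop)]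
  refine lintegral_mono fun x ↦ ?_
  rcases le_total (f x) 1 with h | h
  · exact (ENNReal.rpow_le_rpow_of_exponent_ge h hab).trans le_self_add
  · exact (ENNReal.rpow_le_rpow_of_exponent_le h hbc).trans le_add_self

/-- The key a priori estimate: up to a constant independent of the truncation level `L`, the
nonlinear term tested with the truncated power is an arbitrarily small multiple of the square of
the critical norm of `f * min f L ^ ((r - 2) / 2)`. Both factors are cut at a high level `M`: the
contribution of two large values carries a small constant, a bounded left factor is harmless, and
the Riesz potential of a bounded right factor is a bounded function. -/
theorem exists_rieszEnergy_truncation_le (hn : 3 ≤ n) (hα : α ∈ Ioo (0 : ℝ) n)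
    (hp : p ∈ Icc (((n : ℝ) + α) / n) (((n : ℝ) + α) / (n - 2))) (hr : r ∈ Ico 2 (2 * n / α))
    {f : EuclideanSpace ℝ (Fin n) → ℝ} (hf0 : ∀ x, 0 ≤ f x) (hf : Measurable f)
    (h2 : ∫⁻ x, ENNReal.ofReal (f x) ^ (2 : ℝ) ≠ ⊤)
    (hs : ∫⁻ x, ENNReal.ofReal (f x) ^ (2 * (n : ℝ) / (n - 2)) ≠ ⊤)
    (hfr : ∫⁻ x, ENNReal.ofReal (f x) ^ r ≠ ⊤) {ε : ℝ≥0∞} (hε : ε ≠ 0) :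
    ∃ C : ℝ≥0∞, C ≠ ⊤ ∧ ∀ L : ℝ, 0 < L →
      rieszEnergy volume (n - α) (fun x ↦ ENNReal.ofReal (f x ^ p * min (f x) L ^ (r - 2)))
        (fun x ↦ ENNReal.ofReal (f x ^ p)) ≤
      C + ε * (∫⁻ x, ENNReal.ofReal (f x * min (f x) L ^ ((r - 2) / 2)) ^
        (2 * (n : ℝ) / (n - 2))) ^ (((n : ℝ) - 2) / n) := by
  have hn' : (3 : ℝ) ≤ n := by exact_mod_cast hn
  have hn2 : (0 : ℝ) < n - 2 := by linarith
  have hn0 : (0 : ℝ) < n := by linarith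
  have hα0 := hα.1
  have hαn := hα.2
  obtain ⟨hp1, hp2⟩ := hp
  have hp0 : 0 < p := lt_of_lt_of_le (by positivity) hp1
  have hr2 := hr.1
  obtain ⟨C₃, hC₃, H₃⟩ := exists_rieszEnergy_indicator_le hn hα hp2 hr
  -- The threshold `M`.
  have hε2 : ε / 2 ≠ 0 := by simpa using hε
  obtain ⟨M, hM1, hM⟩ : ∃ M : ℝ, 1 ≤ M ∧ C₃ * (∫⁻ x in {x | M < f x},
      ENNReal.ofReal (f x) ^ (2 * (n : ℝ) / (n - 2))) ^ ((α + 2) / n) ≤ ε / 2 := by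
    have h1 := (ENNReal.continuous_rpow_const (y := (α + 2) / n)).continuousAt.tendsto.comp
      (tendsto_setLIntegral_lt_atTop hf hs)
    rw [ENNReal.zero_rpow_of_pos (by positivity)] at h1
    have h2 := ENNReal.Tendsto.const_mul h1 (Or.inr hC₃)
    rw [mul_zero] at h2
    obtain ⟨M, hM, hM1⟩ := ((h2.eventually_le_const (pos_iff_ne_zero.2 hε2)).and
      (eventually_ge_atTop 1)).exists
    exact ⟨M, hM1, hM⟩
  have hM0 : 0 < M := by linarith
  -- The uniform bound for the Riesz potential of the bounded part.
  set A := {x | M < f x} with hA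
  have hAm : MeasurableSet A := measurableSet_lt measurable_const hf
  set fl : EuclideanSpace ℝ (Fin n) → ℝ := Aᶜ.indicator f with hfl
  have hfl0 : ∀ x, 0 ≤ fl x := fun x ↦ indicator_nonneg (fun x _ ↦ hf0 x) x
  have hflf : ∀ x, fl x ≤ f x := fun x ↦ indicator_le_self' (fun x _ ↦ hf0 x) x
  have hflM : ∀ x, fl x ≤ M := by
    intro x
    by_cases hx : x ∈ A
    · simp [hfl, hx, hM0.le]
    · rw [hfl, indicator_of_mem (show x ∈ Aᶜ from hx)]
      exact not_lt.1 hx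
  have hflm : Measurable fl := hf.indicator hAm.compl
  obtain ⟨C₁, hC₁, H₁⟩ := exists_lintegral_norm_rpow_mul_le hn hα hp1 hfl0 hflm (by
    refine ne_top_of_le_ne_top h2 (lintegral_mono fun x ↦ ?_)
    gcongr
    exact hflf x) hM0 hflM
  obtain ⟨δ, hδ0, hδ⟩ : ∃ δ : ℝ≥0∞, δ ≠ 0 ∧ C₁ * δ ≤ ε / 2 := by
    obtain ⟨d, hd0, hd⟩ := ENNReal.exists_nnreal_pos_mul_lt hC₁ hε2
    exact ⟨d, by exact_mod_cast hd0.ne', by rw [mul_comm]; exact hd.le⟩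
  obtain ⟨C₂, hC₂, H₂⟩ := exists_setLIntegral_rpow_mul_min_rpow_le hn hαn hp2 hr2 hf0 hf hs hfr hδ0
  set Fp : EuclideanSpace ℝ (Fin n) → ℝ≥0∞ := fun x ↦ ENNReal.ofReal (f x ^ p) with hFp
  have hFpm : Measurable Fp := by fun_prop
  obtain ⟨C₀, hC₀, H₀⟩ : ∃ C : ℝ≥0∞, C ≠ ⊤ ∧ rieszEnergy volume (n - α) Fp Fp ≤ C := by
    set a : ℝ := 2 * n / (n + α) with ha
    have ha1 : 1 < a := by rw [ha, one_lt_div (by positivity)]; linarith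
    obtain ⟨C, hC, H⟩ := exists_rieszEnergy_le (volume : Measure (EuclideanSpace ℝ (Fin n)))
      ha1 ha1 (l := n - α) (by linarith) (by rw [finrank_euclideanSpace_fin]; linarith) (by
        rw [finrank_euclideanSpace_fin, ha, one_div_div]; field_simp; ring)
    refine ⟨_, ?_, H Fp Fp (fun x ↦ ENNReal.ofReal_ne_top) (fun x ↦ ENNReal.ofReal_ne_top)
      hFpm hFpm⟩
    have hfin : ∫⁻ x, Fp x ^ a ≠ ⊤ := by
      have e : ∀ x, Fp x ^ a = ENNReal.ofReal (f x) ^ (p * a) := fun x ↦ by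
        simp only [hFp]
        rw [← ENNReal.ofReal_rpow_of_nonneg (hf0 x) hp0.le, ← ENNReal.rpow_mul]
      simp only [e]
      refine ne_top_of_le_ne_top (ENNReal.add_ne_top.2 ⟨h2, hs⟩)
        (lintegral_rpow_le_add_of_le_of_le hf.ennreal_ofReal ?_ ?_)
      · rw [div_le_iff₀ hn0] at hp1
        rw [ha, ← mul_div_assoc, le_div_iff₀ (by positivity)]
        linarith
      · rw [le_div_iff₀ hn2] at hp2
        rw [ha, ← mul_div_assoc, div_le_div_iff₀ (by positivity) hn2]
        nlinarith
    have := ENNReal.rpow_ne_top_of_nonneg (one_div_nonneg.2 (by linarith : (0 : ℝ) ≤ a)) hfin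
    finiteness
  refine ⟨ENNReal.ofReal (M ^ (r - 2)) * C₀ + C₁ * C₂, by finiteness, fun L hL ↦ ?_⟩
  set W := (∫⁻ x, ENNReal.ofReal (f x * min (f x) L ^ ((r - 2) / 2)) ^
        (2 * (n : ℝ) / (n - 2))) ^ (((n : ℝ) - 2) / n) with hW
  set G : EuclideanSpace ℝ (Fin n) → ℝ≥0∞ :=
    fun x ↦ ENNReal.ofReal (f x ^ p * min (f x) L ^ (r - 2)) with hG
  have hGm : Measurable G := by fun_prop
  have hsplitG : ∀ x, G x ≤ ENNReal.ofReal (M ^ (r - 2)) * Fp x + A.indicator G x := by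
    intro x
    by_cases hx : x ∈ A
    · rw [indicator_of_mem hx]; exact le_add_self
    · refine le_trans ?_ le_self_add
      simp only [hG, hFp]
      rw [← ENNReal.ofReal_mul (by positivity), mul_comm]
      have := hf0 x
      have hm0 : 0 ≤ min (f x) L := le_min this hL.le
      have hxM : f x ≤ M := not_lt.1 hx
      have hr2' : 0 ≤ r - 2 := by linarith
      gcongr
      exact (min_le_left _ _).trans hxM
  have hsplitF : ∀ x, Fp x ≤ ENNReal.ofReal (fl x ^ p) + A.indicator Fp x := by
    intro x
    by_cases hx : x ∈ A
    · rw [indicator_of_mem hx]; exact le_add_self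
    · simp [hfl, hx, hFp]
  have hAGm : Measurable (A.indicator G) := hGm.indicator hAm
  have hlow : rieszEnergy volume (n - α) (A.indicator G) (fun x ↦ ENNReal.ofReal (fl x ^ p)) ≤
      C₁ * (C₂ + δ * W) := by
    calc _ ≤ ∫⁻ x, A.indicator G x * C₁ := by
          refine lintegral_mono fun x ↦ ?_
          gcongr
          exact H₁ x
      _ = C₁ * ∫⁻ x in A, G x := by
          rw [lintegral_mul_const _ hAGm, lintegral_indicator hAm, mul_comm]
      _ ≤ C₁ * (C₂ + δ * W) := by
          gcongr
          refine (lintegral_mono_set fun x (hx : M < f x) ↦ ?_).trans (H₂ L hL)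
          exact hM1.trans_lt hx
  calc rieszEnergy volume (n - α) G Fp
      ≤ rieszEnergy volume (n - α) (fun x ↦ ENNReal.ofReal (M ^ (r - 2)) * Fp x + A.indicator G x)
          Fp := rieszEnergy_mono hsplitG fun _ ↦ le_rfl
    _ = ENNReal.ofReal (M ^ (r - 2)) * rieszEnergy volume (n - α) Fp Fp +
          rieszEnergy volume (n - α) (A.indicator G) Fp := by
        rw [rieszEnergy_add_left (by fun_prop) hFpm,
          rieszEnergy_const_mul_left ENNReal.ofReal_ne_top]
    _ ≤ ENNReal.ofReal (M ^ (r - 2)) * C₀ +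
          (rieszEnergy volume (n - α) (A.indicator G) (fun x ↦ ENNReal.ofReal (fl x ^ p)) +
            rieszEnergy volume (n - α) (A.indicator G) (A.indicator Fp)) := by
        gcongr
        refine (rieszEnergy_mono (fun _ ↦ le_rfl) hsplitF).trans_eq ?_
        exact rieszEnergy_add_right hAGm (by fun_prop)
    _ ≤ ENNReal.ofReal (M ^ (r - 2)) * C₀ + (C₁ * (C₂ + δ * W) + ε / 2 * W) := by
        gcongr
        refine (H₃ f hf0 hf M hM1 L hL).trans ?_
        rw [← mul_assoc]
        gcongr
    _ = ENNReal.ofReal (M ^ (r - 2)) * C₀ + C₁ * C₂ + (C₁ * δ + ε / 2) * W := by ring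
    _ ≤ ENNReal.ofReal (M ^ (r - 2)) * C₀ + C₁ * C₂ + (ε / 2 + ε / 2) * W := by gcongr
    _ = _ := by rw [ENNReal.add_halves]

end Truncation

/-! ### Truncated powers as test functions -/

section TruncatedPower

/-- The primitive of `min |s| L ^ γ` that vanishes at the origin: a `C¹` substitute for the
truncated power `t * min |t| L ^ γ`, to which it is comparable. -/
noncomputable def truncPow (γ L t : ℝ) : ℝ := ∫ s in (0 : ℝ)..t, min |s| L ^ γ

variable {γ L : ℝ}

theorem continuous_min_abs_rpow (hγ : 0 ≤ γ) : Continuous fun s : ℝ ↦ min |s| L ^ γ :=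
  (continuous_abs.min continuous_const).rpow_const fun _ ↦ Or.inr hγ

theorem min_abs_rpow_nonneg (hL : 0 < L) (s : ℝ) : 0 ≤ min |s| L ^ γ :=
  Real.rpow_nonneg (le_min (abs_nonneg s) hL.le) γ

theorem truncPow_zero : truncPow γ L 0 = 0 := by simp [truncPow]

theorem hasDerivAt_truncPow (hγ : 0 ≤ γ) (t : ℝ) :
    HasDerivAt (truncPow γ L) (min |t| L ^ γ) t :=
  intervalIntegral.integral_hasDerivAt_right ((continuous_min_abs_rpow hγ).intervalIntegrable _ _)
    ((continuous_min_abs_rpow hγ).stronglyMeasurableAtFilter _ _)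
    (continuous_min_abs_rpow hγ).continuousAt

theorem monotone_truncPow (hγ : 0 ≤ γ) (hL : 0 < L) : Monotone (truncPow γ L) :=
  monotone_of_hasDerivAt_nonneg (hasDerivAt_truncPow hγ) (min_abs_rpow_nonneg hL)

theorem truncPow_neg (t : ℝ) : truncPow γ L (-t) = -truncPow γ L t := by
  have h := intervalIntegral.integral_comp_neg (f := fun s : ℝ ↦ min |s| L ^ γ) (a := 0) (b := t)
  simp only [abs_neg, neg_zero] at h
  rw [truncPow, truncPow, h, intervalIntegral.integral_symm]

theorem abs_truncPow (hγ : 0 ≤ γ) (hL : 0 < L) (t : ℝ) :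
    |truncPow γ L t| = truncPow γ L |t| := by
  have hpos : ∀ s : ℝ, 0 ≤ s → 0 ≤ truncPow γ L s := fun s hs ↦ by
    have := monotone_truncPow hγ hL hs
    rwa [truncPow_zero] at this
  rcases le_total 0 t with h | h
  · rw [abs_of_nonneg h, abs_of_nonneg (hpos t h)]
  · rw [abs_of_nonpos h, truncPow_neg, abs_of_nonpos]
    have := hpos (-t) (by linarith)
    rw [truncPow_neg] at this
    linarith

theorem abs_truncPow_le (hγ : 0 ≤ γ) (hL : 0 < L) (t : ℝ) :
    |truncPow γ L t| ≤ |t| * min |t| L ^ γ := by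
  rw [abs_truncPow hγ hL, truncPow]
  calc ∫ s in (0 : ℝ)..|t|, min |s| L ^ γ ≤ ∫ s in (0 : ℝ)..|t|, min |t| L ^ γ := by
        refine intervalIntegral.integral_mono_on (abs_nonneg t)
          ((continuous_min_abs_rpow hγ).intervalIntegrable _ _) (by simp) fun s hs ↦ ?_
        have h0 : 0 ≤ min |s| L := le_min (abs_nonneg s) hL.le
        refine Real.rpow_le_rpow h0 (min_le_min_right _ ?_) hγ
        rw [abs_of_nonneg hs.1]
        exact hs.2
    _ = |t| * min |t| L ^ γ := by simp

theorem le_abs_truncPow (hγ : 0 ≤ γ) (hL : 0 < L) (t : ℝ) :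
    (1 / 2) ^ (γ + 1) * (|t| * min |t| L ^ γ) ≤ |truncPow γ L t| := by
  rw [abs_truncPow hγ hL]
  have ht := abs_nonneg t
  set τ := |t| with hτ
  have hm : 0 ≤ min τ L := le_min ht hL.le
  have hc := continuous_min_abs_rpow (L := L) hγ
  have h1 : truncPow γ L τ = truncPow γ L (τ / 2) + ∫ s in (τ / 2)..τ, min |s| L ^ γ :=
    (intervalIntegral.integral_add_adjacent_intervals (hc.intervalIntegrable _ _)
      (hc.intervalIntegrable _ _)).symm
  have h2 : 0 ≤ truncPow γ L (τ / 2) := by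
    have := monotone_truncPow hγ hL (show (0 : ℝ) ≤ τ / 2 by positivity)
    rwa [truncPow_zero] at this
  have h3 : ∫ _ in (τ / 2)..τ, (min τ L / 2) ^ γ ≤ ∫ s in (τ / 2)..τ, min |s| L ^ γ := by
    refine intervalIntegral.integral_mono_on (by linarith) (by simp) (hc.intervalIntegrable _ _)
      fun s hs ↦ ?_
    gcongr
    rw [abs_of_nonneg (by linarith [hs.1])]
    refine le_min ?_ ?_
    · linarith [hs.1, min_le_left τ L]
    · linarith [min_le_right τ L]
  have h4 : (1 / 2 : ℝ) ^ (γ + 1) * (τ * min τ L ^ γ) = ∫ _ in (τ / 2)..τ, (min τ L / 2) ^ γ := by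
    rw [intervalIntegral.integral_const, smul_eq_mul, div_eq_mul_one_div (min τ L) 2,
      Real.mul_rpow hm (by norm_num), Real.rpow_add_one (by norm_num)]
    ring
  linarith

end TruncatedPower

/-! ### Testing the equation and the bootstrap -/

section WeakSolution

variable {n : ℕ} {α s p lam μ τ r : ℝ} {u : EuclideanSpace ℝ (Fin n) → ℝ}

theorem gagliardoForm_nonneg_of_monotone [NeZero n] {Θ : ℝ → ℝ} (hΘ : Monotone Θ) :
    0 ≤ gagliardoForm n s u fun x ↦ Θ (u x) := by
  refine mul_nonneg (div_nonneg (inv_nonneg.2 (integral_nonneg fun x ↦ ?_)) (by norm_num))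
    (integral_nonneg fun z ↦ ?_)
  · have := Real.cos_le_one (x 0)
    simp only [Pi.zero_apply]
    apply div_nonneg (by linarith) (by positivity)
  · refine div_nonneg ?_ (by positivity)
    rcases le_total (u z.1) (u z.2) with h | h
    · exact mul_nonneg_of_nonpos_of_nonpos (by linarith) (by linarith [hΘ h])
    · exact mul_nonneg (by linarith) (by linarith [hΘ h])

theorem MemH1With.comp_truncPow {g : EuclideanSpace ℝ (Fin n) → EuclideanSpace ℝ (Fin n)}
    (h : MemH1With u g) {γ L : ℝ} (hγ : 0 ≤ γ) (hL : 0 < L) :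
    MemH1With (fun x ↦ truncPow γ L (u x)) (fun x ↦ min |u x| L ^ γ • g x) := by
  refine h.comp_of_deriv_le (K := L ^ γ) (hasDerivAt_truncPow hγ) (continuous_min_abs_rpow hγ)
    truncPow_zero fun t ↦ ?_
  rw [abs_of_nonneg (min_abs_rpow_nonneg hL t)]
  have : 0 ≤ min |t| L := le_min (abs_nonneg t) hL.le
  gcongr
  exact min_le_right _ _

/-- Testing the equation with `truncPow (r - 2) L ∘ u`: the nonlocal and the zeroth order terms
are nonnegative and can be dropped. -/
theorem IsWeakSolution.integral_norm_sq_le [NeZero n] (hu : IsWeakSolution n α s p lam μ τ u)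
    (hlam : 0 < lam) (hr : 2 ≤ r) {L : ℝ} (hL : 0 < L)
    {g : EuclideanSpace ℝ (Fin n) → EuclideanSpace ℝ (Fin n)} (h : MemH1With u g) :
    ∫ x, ‖min |u x| L ^ ((r - 2) / 2) • g x‖ ^ 2 ≤
      μ * ∫ x, (rieszKernel n α ⋆[ContinuousLinearMap.mul ℝ ℝ, volume] fun y ↦ |u y| ^ p) x *
        (|u x| ^ (p - 2) * u x * truncPow (r - 2) L (u x)) := by
  have hr' : 0 ≤ r - 2 := by linarith
  have hmono := monotone_truncPow hr' hL
  have h1 := hu.weak_eq g h _ _ (h.comp_truncPow hr' hL)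
  have h2 : 0 ≤ gagliardoForm n s u fun x ↦ truncPow (r - 2) L (u x) :=
    gagliardoForm_nonneg_of_monotone hmono
  have h3 : 0 ≤ ∫ x, u x * truncPow (r - 2) L (u x) := by
    refine integral_nonneg fun x ↦ ?_
    simp only [Pi.zero_apply]
    rcases le_total 0 (u x) with h | h
    · have := hmono h
      rw [truncPow_zero] at this
      exact mul_nonneg h this
    · have := hmono h
      rw [truncPow_zero] at this
      exact mul_nonneg_of_nonpos_of_nonpos h this
  have h4 : ∫ x, inner ℝ (g x) (min |u x| L ^ (r - 2) • g x) =
      ∫ x, ‖min |u x| L ^ ((r - 2) / 2) • g x‖ ^ 2 := by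
    refine integral_congr_ae (Eventually.of_forall fun x ↦ ?_)
    have hm : 0 ≤ min |u x| L := le_min (abs_nonneg _) hL.le
    simp only
    rw [real_inner_smul_right, real_inner_self_eq_norm_sq, norm_smul, mul_pow,
      Real.norm_of_nonneg (Real.rpow_nonneg hm _), ← Real.rpow_natCast (_ ^ _), ← Real.rpow_mul hm]
    norm_num
  rw [← h1, ← h4]
  have := mul_nonneg hlam.le h2
  linarith

theorem rieszEnergy_congr_ae {E : Type*} [NormedAddCommGroup E] [MeasurableSpace E]
    {μ : Measure E} {l : ℝ} {F F' G G' : E → ℝ≥0∞} (hF : F =ᵐ[μ] F') (hG : G =ᵐ[μ] G') :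
    rieszEnergy μ l F G = rieszEnergy μ l F' G' := by
  refine lintegral_congr_ae ?_
  filter_upwards [hF] with x hx
  rw [hx]
  congr 1
  refine lintegral_congr_ae ?_
  filter_upwards [hG] with y hy
  rw [hy]

theorem enorm_rieszKernel (x : EuclideanSpace ℝ (Fin n)) :
    ‖rieszKernel n α x‖ₑ = ‖Real.Gamma (((n : ℝ) - α) / 2) /
      (Real.pi ^ ((n : ℝ) / 2) * (2 : ℝ) ^ α * Real.Gamma (α / 2))‖ₑ *
        ENNReal.ofReal (‖x‖ ^ (-((n : ℝ) - α))) := by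
  rw [rieszKernel, div_eq_mul_inv _ (‖x‖ ^ _), enorm_mul, ← Real.rpow_neg (norm_nonneg _),
    Real.enorm_of_nonneg (by positivity : 0 ≤ ‖x‖ ^ (-((n : ℝ) - α)))]

/-- The nonlinear term is bounded by a Riesz energy. No integrability is needed here: where an
integral diverges its value is zero. -/
theorem enorm_integral_rieszKernel_convolution_le (hp : 1 < p) (hr : 2 ≤ r) {L : ℝ} (hL : 0 < L) :
    ‖∫ x, (rieszKernel n α ⋆[ContinuousLinearMap.mul ℝ ℝ, volume] fun y ↦ |u y| ^ p) x *
        (|u x| ^ (p - 2) * u x * truncPow (r - 2) L (u x))‖ₑ ≤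
      ‖Real.Gamma (((n : ℝ) - α) / 2) /
        (Real.pi ^ ((n : ℝ) / 2) * (2 : ℝ) ^ α * Real.Gamma (α / 2))‖ₑ *
      rieszEnergy volume (n - α) (fun x ↦ ENNReal.ofReal (|u x| ^ p * min |u x| L ^ (r - 2)))
        (fun x ↦ ENNReal.ofReal (|u x| ^ p)) := by
  set A := Real.Gamma (((n : ℝ) - α) / 2) /
        (Real.pi ^ ((n : ℝ) / 2) * (2 : ℝ) ^ α * Real.Gamma (α / 2)) with hA
  refine (enorm_integral_le_lintegral_enorm _).trans ?_
  rw [rieszEnergy, ← lintegral_const_mul' _ _ (by finiteness)]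
  refine lintegral_mono fun x ↦ ?_
  rw [enorm_mul]
  have h1 : ‖(rieszKernel n α ⋆[ContinuousLinearMap.mul ℝ ℝ, volume] fun y ↦ |u y| ^ p) x‖ₑ ≤
      ‖A‖ₑ * ∫⁻ y, ENNReal.ofReal (‖x - y‖ ^ (-((n : ℝ) - α))) * ENNReal.ofReal (|u y| ^ p) := by
    rw [convolution_eq_swap, ← lintegral_const_mul' _ _ (by finiteness)]
    refine (enorm_integral_le_lintegral_enorm _).trans (lintegral_mono fun y ↦ le_of_eq ?_)
    rw [ContinuousLinearMap.mul_apply', enorm_mul, enorm_rieszKernel, mul_assoc,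
      Real.enorm_of_nonneg (by positivity : 0 ≤ |u y| ^ p)]
  have h2 : ‖|u x| ^ (p - 2) * u x * truncPow (r - 2) L (u x)‖ₑ ≤
      ENNReal.ofReal (|u x| ^ p * min |u x| L ^ (r - 2)) := by
    rw [← ofReal_norm]
    refine ENNReal.ofReal_le_ofReal ?_
    rw [norm_mul, norm_mul, Real.norm_eq_abs (u x), Real.norm_eq_abs (truncPow _ _ _),
      Real.norm_of_nonneg (by positivity)]
    have h3 := abs_truncPow_le (by linarith : 0 ≤ r - 2) hL (u x)
    rcases eq_or_ne (u x) 0 with h0 | h0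
    · rw [h0, abs_zero, mul_zero, zero_mul]
      rw [Real.zero_rpow (by linarith), zero_mul]
    · have hpos : 0 < |u x| := abs_pos.2 h0
      calc |u x| ^ (p - 2) * |u x| * |truncPow (r - 2) L (u x)|
          ≤ |u x| ^ (p - 2) * |u x| * (|u x| * min |u x| L ^ (r - 2)) := by gcongr
        _ = |u x| ^ p * min |u x| L ^ (r - 2) := by
            have e : |u x| ^ p = |u x| ^ (p - 2) * |u x| ^ (2 : ℝ) := by
              rw [← Real.rpow_add hpos]; congr 1; ring
            rw [e, Real.rpow_two]
            ring
  calc _ ≤ (‖A‖ₑ * ∫⁻ y, ENNReal.ofReal (‖x - y‖ ^ (-((n : ℝ) - α))) *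
        ENNReal.ofReal (|u y| ^ p)) * ENNReal.ofReal (|u x| ^ p * min |u x| L ^ (r - 2)) :=
        mul_le_mul' h1 h2
    _ = _ := by ring

theorem memLp_ofReal_iff {X : Type*} [MeasurableSpace X] {μ : Measure X} {u : X → ℝ}
    (hu : AEStronglyMeasurable u μ) {q : ℝ} (hq : 0 < q) :
    MemLp u (ENNReal.ofReal q) μ ↔ ∫⁻ x, ‖u x‖ₑ ^ q ∂μ ≠ ⊤ := by
  rw [MemLp, and_iff_right hu, eLpNorm_lt_top_iff_lintegral_rpow_enorm_lt_top (by simpa using hq)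
    ENNReal.ofReal_ne_top, ENNReal.toReal_ofReal hq.le, lt_top_iff_ne_top]

theorem le_of_mul_le_mul_add_of_le_half {W K C ε c : ℝ≥0∞} (hW : W ≠ ⊤) (hc0 : c ≠ 0) (hc : c ≠ ⊤)
    (hε : K * ε ≤ c / 2) (h : c * W ≤ K * (C + ε * W)) : W ≤ K * C / (c / 2) := by
  have h1 : c / 2 * W + c / 2 * W ≤ K * C + c / 2 * W := by
    calc c / 2 * W + c / 2 * W = c * W := by rw [← add_mul, ENNReal.add_halves]
      _ ≤ K * (C + ε * W) := h
      _ = K * C + K * ε * W := by ring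
      _ ≤ K * C + c / 2 * W := by gcongr
  have h2 : c / 2 * W ≤ K * C :=
    (ENNReal.add_le_add_iff_right (ENNReal.mul_ne_top (by finiteness) hW)).1 h1
  rw [ENNReal.le_div_iff_mul_le (Or.inl (by simpa using hc0)) (Or.inl (by finiteness)), mul_comm]
  exact h2

/-- One step of the bootstrap: integrability of order `r < 2 n / α` improves by the factor
`n / (n - 2)`. -/
theorem IsWeakSolution.memLp_mul_div [NeZero n] (hu : IsWeakSolution n α s p lam μ τ u)
    (hn : 3 ≤ n) (hα : α ∈ Ioo (0 : ℝ) n)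
    (hp : p ∈ Icc (((n : ℝ) + α) / n) (((n : ℝ) + α) / (n - 2))) (hlam : 0 < lam)
    (hr : r ∈ Ico 2 (2 * n / α)) (hur : MemLp u (ENNReal.ofReal r)) :
    MemLp u (ENNReal.ofReal (r * (n / (n - 2)))) := by
  have hn' : (3 : ℝ) ≤ n := by exact_mod_cast hn
  have hn2 : (0 : ℝ) < n - 2 := by linarith
  have hn0 : (0 : ℝ) < n := by linarith
  have hr2 := hr.1
  have hγ : 0 ≤ (r - 2) / 2 := by linarith
  have hp1 : 1 < p := lt_of_lt_of_le (by rw [one_lt_div hn0]; linarith [hα.1]) hp.1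
  obtain ⟨g, hg⟩ := hu.memH1
  have hum := hg.memLp.1
  obtain ⟨Cs, hCs, hsob⟩ := exists_eLpNorm_le_of_memH1With hn
  set σ := 2 * (n : ℝ) / (n - 2) with hσ
  have hσ0 : 0 < σ := by positivity
  have h2σ : 2 / σ = ((n : ℝ) - 2) / n := by rw [hσ]; field_simp
  have husσ : MemLp u (ENNReal.ofReal σ) :=
    ⟨hum, (hsob u g hg).trans_lt (ENNReal.mul_lt_top hCs.lt_top hg.memLp_grad.2)⟩
  -- A measurable representative of `|u|`.
  set f : EuclideanSpace ℝ (Fin n) → ℝ := fun x ↦ |hum.mk u x| with hf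
  have hfm : Measurable f := hum.stronglyMeasurable_mk.measurable.abs
  have hf0 : ∀ x, 0 ≤ f x := fun x ↦ abs_nonneg _
  have huf : ∀ᵐ x, |u x| = f x := by
    filter_upwards [hum.ae_eq_mk] with x hx
    rw [hf, hx]
  have hint : ∀ q : ℝ, ∫⁻ x, ‖u x‖ₑ ^ q = ∫⁻ x, ENNReal.ofReal (f x) ^ q := fun q ↦ by
    refine lintegral_congr_ae ?_
    filter_upwards [huf] with x hx
    rw [← hx, ← Real.norm_eq_abs, ofReal_norm]
  have hfint : ∀ q : ℝ, 0 < q → MemLp u (ENNReal.ofReal q) →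
      ∫⁻ x, ENNReal.ofReal (f x) ^ q ≠ ⊤ := fun q hq hmem ↦ by
    rw [← hint]; exact (memLp_ofReal_iff hum hq).1 hmem
  have hf2 := hfint 2 (by norm_num) (by simpa using hg.memLp)
  have hfσ := hfint σ hσ0 husσ
  have hfr := hfint r (by linarith) hur
  set A := ‖Real.Gamma (((n : ℝ) - α) / 2) /
        (Real.pi ^ ((n : ℝ) / 2) * (2 : ℝ) ^ α * Real.Gamma (α / 2))‖ₑ with hA
  set c := ENNReal.ofReal ((1 / 2) ^ ((r - 2) / 2 + 1)) with hc
  have hc0 : c ≠ 0 := by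
    rw [hc, Ne, ENNReal.ofReal_eq_zero, not_le]; positivity
  have hct : c ≠ ⊤ := ENNReal.ofReal_ne_top
  set K := Cs ^ 2 * (‖μ‖ₑ * A) with hK
  have hKt : K ≠ ⊤ := by finiteness
  obtain ⟨ε, hε0, hε⟩ : ∃ ε : ℝ≥0∞, ε ≠ 0 ∧ K * ε ≤ c ^ 2 / 2 := by
    obtain ⟨d, hd0, hd⟩ := ENNReal.exists_nnreal_pos_mul_lt hKt
      (show c ^ 2 / 2 ≠ 0 by simpa using hc0)
    exact ⟨d, by exact_mod_cast hd0.ne', by rw [mul_comm]; exact hd.le⟩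
  obtain ⟨C, hC, hRHS⟩ := exists_rieszEnergy_truncation_le hn hα hp hr hf0 hfm hf2 hfσ hfr hε0
  set wL : ℝ → EuclideanSpace ℝ (Fin n) → ℝ≥0∞ :=
    fun L x ↦ ENNReal.ofReal (f x * min (f x) L ^ ((r - 2) / 2)) with hwL
  have hwLm : ∀ L, Measurable (wL L) := fun L ↦ by fun_prop
  set W : ℝ → ℝ≥0∞ := fun L ↦ (∫⁻ x, wL L x ^ σ) ^ (((n : ℝ) - 2) / n) with hW
  have hWt : ∀ L : ℝ, 0 < L → W L ≠ ⊤ := by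
    intro L hL
    refine ENNReal.rpow_ne_top_of_nonneg (by positivity) ?_
    have hb : ∀ x, wL L x ^ σ ≤
        ENNReal.ofReal (L ^ ((r - 2) / 2)) ^ σ * ENNReal.ofReal (f x) ^ σ := by
      intro x
      rw [← ENNReal.mul_rpow_of_nonneg _ _ hσ0.le, ← ENNReal.ofReal_mul (by positivity), mul_comm]
      have hm : 0 ≤ min (f x) L := le_min (hf0 x) hL.le
      have := hf0 x
      simp only [hwL]
      gcongr
      exact min_le_right _ _
    refine ne_top_of_le_ne_top ?_ (lintegral_mono hb)
    rw [lintegral_const_mul _ (by fun_prop)]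
    exact ENNReal.mul_ne_top (ENNReal.rpow_ne_top_of_nonneg hσ0.le ENNReal.ofReal_ne_top) hfσ
  have hbound : ∀ L : ℝ, 0 < L → W L ≤ K * C / (c ^ 2 / 2) := by
    intro L hL
    refine le_of_mul_le_mul_add_of_le_half (hWt L hL) (pow_ne_zero 2 hc0) (by finiteness) hε ?_
    have hw := hg.comp_truncPow hγ hL
    set Dw := fun x ↦ min |u x| L ^ ((r - 2) / 2) • g x with hDw
    -- The gradient is bounded by the nonlinear term.
    have hgrad : eLpNorm Dw 2 volume ^ 2 ≤ ‖μ‖ₑ * A * (C + ε * W L) := by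
      have e1 : eLpNorm Dw 2 volume ^ 2 = ENNReal.ofReal (∫ x, ‖Dw x‖ ^ 2) := by
        rw [ofReal_integral_eq_lintegral_ofReal
          (MemLp.integrable_norm_pow (p := 2) (by exact_mod_cast hw.memLp_grad) two_ne_zero)
          (Eventually.of_forall fun x ↦ by positivity),
          eLpNorm_eq_lintegral_rpow_enorm_toReal (by norm_num) (by norm_num),
          ← ENNReal.rpow_natCast, ← ENNReal.rpow_mul]
        norm_num
      rw [e1]
      refine (ENNReal.ofReal_le_ofReal (hu.integral_norm_sq_le hlam hr2 hL hg)).trans ?_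
      refine (Real.ofReal_le_enorm _).trans ?_
      rw [enorm_mul, mul_assoc]
      gcongr
      refine (enorm_integral_rieszKernel_convolution_le hp1 hr2 hL).trans ?_
      refine mul_le_mul' le_rfl (le_trans (le_of_eq ?_) (hRHS L hL))
      refine rieszEnergy_congr_ae ?_ ?_
      · filter_upwards [huf] with x hx
        rw [hx]
      · filter_upwards [huf] with x hx
        rw [hx]
    -- The Sobolev inequality for `truncPow ((r - 2) / 2) L ∘ u`.
    have hWsob : c ^ 2 * W L ≤
        eLpNorm (fun x ↦ truncPow ((r - 2) / 2) L (u x)) (ENNReal.ofReal σ) volume ^ 2 := by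
      rw [eLpNorm_eq_lintegral_rpow_enorm_toReal (by simpa using hσ0) ENNReal.ofReal_ne_top,
        ENNReal.toReal_ofReal hσ0.le, ← ENNReal.rpow_natCast (_ ^ _), ← ENNReal.rpow_mul,
        ← ENNReal.rpow_natCast]
      have e : 1 / σ * ((2 : ℕ) : ℝ) = ((n : ℝ) - 2) / n := by rw [← h2σ]; push_cast; ring
      have e' : c ^ ((2 : ℕ) : ℝ) = (c ^ σ) ^ (((n : ℝ) - 2) / n) := by
        rw [← ENNReal.rpow_mul, ← h2σ]
        congr 1
        push_cast
        field_simp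
      rw [e, e']
      simp only [hW]
      rw [← ENNReal.mul_rpow_of_nonneg _ _ (by positivity),
        ← lintegral_const_mul _ ((hwLm L).pow_const σ)]
      refine ENNReal.rpow_le_rpow (lintegral_mono_ae ?_) (by positivity)
      filter_upwards [huf] with x hx
      rw [← ENNReal.mul_rpow_of_nonneg _ _ hσ0.le]
      refine ENNReal.rpow_le_rpow ?_ hσ0.le
      simp only [hwL, hc]
      rw [← ENNReal.ofReal_mul (by positivity), ← hx, ← ofReal_norm, Real.norm_eq_abs]
      exact ENNReal.ofReal_le_ofReal (le_abs_truncPow hγ hL (u x))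
    calc c ^ 2 * W L ≤ (Cs * eLpNorm Dw 2 volume) ^ 2 :=
          hWsob.trans (by gcongr; exact hsob _ _ hw)
      _ = Cs ^ 2 * eLpNorm Dw 2 volume ^ 2 := by ring
      _ ≤ Cs ^ 2 * (‖μ‖ₑ * A * (C + ε * W L)) := by gcongr
      _ = K * (C + ε * W L) := by rw [hK]; ring
  -- Removing the truncation.
  set B := K * C / (c ^ 2 / 2) with hB
  have hBt : B ≠ ⊤ := ENNReal.div_ne_top (by finiteness) (by simpa using hc0)
  rw [memLp_ofReal_iff hum (by positivity), hint]
  have hle : ∀ k : ℕ, ∫⁻ x, wL (k + 1) x ^ σ ≤ B ^ ((n : ℝ) / (n - 2)) := by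
    intro k
    have := ENNReal.rpow_le_rpow (hbound (k + 1) (by positivity))
      (by positivity : 0 ≤ (n : ℝ) / (n - 2))
    simp only [hW] at this
    rwa [← ENNReal.rpow_mul, show ((n : ℝ) - 2) / n * (n / (n - 2)) = 1 by field_simp,
      ENNReal.rpow_one] at this
  refine ne_top_of_le_ne_top
    (ENNReal.rpow_ne_top_of_nonneg (y := (n : ℝ) / (n - 2)) (by positivity) hBt) ?_
  calc ∫⁻ x, ENNReal.ofReal (f x) ^ (r * (n / (n - 2)))
      = ∫⁻ x, liminf (fun k : ℕ ↦ wL (k + 1) x ^ σ) atTop := by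
        refine lintegral_congr fun x ↦ ?_
        obtain ⟨k₀, hk₀⟩ := exists_nat_ge (f x)
        have : ∀ᶠ k : ℕ in atTop,
            wL (k + 1) x ^ σ = ENNReal.ofReal (f x) ^ (r * (n / (n - 2))) := by
          filter_upwards [eventually_ge_atTop k₀] with k hk
          have h1 : (k₀ : ℝ) ≤ k := by exact_mod_cast hk
          simp only [hwL]
          rw [min_eq_left (by linarith), ← Real.rpow_one_add' (hf0 x) (by linarith),
            ← ENNReal.ofReal_rpow_of_nonneg (hf0 x) (by linarith), ← ENNReal.rpow_mul]
          congr 1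
          rw [hσ]
          field_simp
          ring
        exact ((tendsto_congr' this).2 tendsto_const_nhds).liminf_eq.symm
    _ ≤ liminf (fun k : ℕ ↦ ∫⁻ x, wL (k + 1) x ^ σ) atTop :=
        lintegral_liminf_le fun k ↦ (hwLm _).pow_const σ
    _ ≤ liminf (fun _ : ℕ ↦ B ^ ((n : ℝ) / (n - 2))) atTop :=
        liminf_le_liminf (Eventually.of_forall hle)
    _ = _ := liminf_const _

theorem memLp_ofReal_of_le_of_le {X : Type*} [MeasurableSpace X] {μ : Measure X} {u : X → ℝ}
    {a b c : ℝ} (ha : 0 < a) (hab : a ≤ b) (hbc : b ≤ c) (h₁ : MemLp u (ENNReal.ofReal a) μ)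
    (h₂ : MemLp u (ENNReal.ofReal c) μ) : MemLp u (ENNReal.ofReal b) μ := by
  wlog hu : StronglyMeasurable u generalizing u
  · have e := h₁.1.ae_eq_mk
    exact (memLp_congr_ae e).2 (this ((memLp_congr_ae e).1 h₁) ((memLp_congr_ae e).1 h₂)
      h₁.1.stronglyMeasurable_mk)
  rw [memLp_ofReal_iff h₁.1 (by linarith)] at *
  exact ne_top_of_le_ne_top (ENNReal.add_ne_top.2 ⟨h₁, h₂⟩)
    (lintegral_rpow_le_add_of_le_of_le hu.enorm hab hbc)

theorem IsWeakSolution.memLp_of_le_two_mul_pow [NeZero n] (hu : IsWeakSolution n α s p lam μ τ u)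
    (hn : 3 ≤ n) (hα : α ∈ Ioo (0 : ℝ) n)
    (hp : p ∈ Icc (((n : ℝ) + α) / n) (((n : ℝ) + α) / (n - 2))) (hlam : 0 < lam) (k : ℕ) :
    ∀ q ∈ Ico (2 : ℝ) ((n : ℝ) / α * (2 * (n : ℝ) / ((n : ℝ) - 2))),
      q ≤ 2 * ((n : ℝ) / (n - 2)) ^ k → MemLp u (ENNReal.ofReal q) := by
  have hn' : (3 : ℝ) ≤ n := by exact_mod_cast hn
  have hn2 : (0 : ℝ) < n - 2 := by linarith
  have hn0 : (0 : ℝ) < n := by linarith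
  obtain ⟨hα0, hαn⟩ := hα
  have hu2 : MemLp u (ENNReal.ofReal 2) := by
    obtain ⟨g, hg⟩ := hu.memH1
    simpa using hg.memLp
  have hχ : 1 < (n : ℝ) / (n - 2) := by rw [one_lt_div hn2]; linarith
  induction k with
  | zero =>
    intro q hq hqk
    rw [pow_zero, mul_one] at hqk
    rwa [le_antisymm hqk hq.1]
  | succ k ih =>
    intro q hq hqk
    set χ := (n : ℝ) / (n - 2) with hχ'
    have hχ0 : 0 < χ := by linarith
    have hα2 : 2 < 2 * n / α := by rw [lt_div_iff₀ hα0]; linarith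
    have hr : max 2 (q / χ) ∈ Ico 2 (2 * n / α) := by
      refine ⟨le_max_left _ _, max_lt hα2 ?_⟩
      rw [div_lt_iff₀ hχ0]
      refine hq.2.trans_eq ?_
      rw [hχ']; field_simp
    have hrχ : q ≤ max 2 (q / χ) * χ := (div_le_iff₀ hχ0).1 (le_max_right _ _)
    refine memLp_ofReal_of_le_of_le two_pos hq.1 hrχ hu2
      (hu.memLp_mul_div hn ⟨hα0, hαn⟩ hp hlam hr (ih _ ⟨hr.1, hr.2.trans ?_⟩ (max_le ?_ ?_)))
    · have : (n : ℝ) / α * (2 * n / (n - 2)) = 2 * n / α * χ := by rw [hχ']; field_simp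
      rw [this]
      exact lt_mul_of_one_lt_right (by positivity) hχ
    · have := one_le_pow₀ hχ.le (n := k)
      linarith
    · rw [div_le_iff₀ hχ0]
      rw [pow_succ] at hqk
      linarith

end WeakSolution

end Choquard

theorem theorem1p1 (n : ℕ) [NeZero n] (hn : 3 ≤ n) (α : ℝ) (hα : α ∈ Set.Ioo (0 : ℝ) n)
    (s : ℝ) (hs : s ∈ Set.Ioo (0 : ℝ) 1)
    (p : ℝ) (hp : p ∈ Set.Icc (((n : ℝ) + α) / n) (((n : ℝ) + α) / ((n : ℝ) - 2)))
    (lam μ τ : ℝ) (hlam : 0 < lam) (hμ : 0 < μ) (hτ : 0 < τ)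
    (u : EuclideanSpace ℝ (Fin n) → ℝ) (hu : Choquard.IsWeakSolution n α s p lam μ τ u)
    (q : ℝ) (hq : q ∈ Set.Ico (2 : ℝ) ((n : ℝ) / α * (2 * (n : ℝ) / ((n : ℝ) - 2)))) :
    MemLp u (ENNReal.ofReal q) := by
  have hn' : (3 : ℝ) ≤ n := by exact_mod_cast hn
  have hχ : 1 < (n : ℝ) / (n - 2) := by rw [one_lt_div (by linarith)]; linarith
  obtain ⟨k, hk⟩ := pow_unbounded_of_one_lt (q / 2) hχ
  exact hu.memLp_of_le_two_mul_pow hn hα hp hlam k q hq (by linarith)
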